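/- \textbf{Definitions.} For $k\in\omega$, an instance of $\mathsf{RT}^1_k$ is a coloring $C:\omega\to k$, and a solution to $C$ is an infinite set $G\subseteq\omega$ on which $C$ is constant. An instance of $(\mathsf{RT}^1_2)^{<\omega}$ is, for some $r\in\omega$, an $r$-tuple $(C_0,\dots,C_{r-1})$ of colorings $C_s:\omega\to 2$; a solution to it is an $r$-tuple $(G_0,\dots,G_{r-1})$ of infinite sets such that $C_s$ is constant on $G_s$ for every $s<r$. A problem $\mathsf{P}_0$ is \emph{soc-reducible} to $\mathsf{P}_1$, written $\mathsf{P}_0\leq_{soc}\mathsf{P}_1$, if for every $\mathsf{P}_0$-instance $I_0$ there is a $\mathsf{P}_1$-instance $I_1$ such that every solution to $I_1$ Turing computes a solution to $I_0$; a tuple of sets is used as an oracle through its join. A coloring $C:\omega\to k$ is \emph{hyperimmune relative to} $D\subseteq\omega$ if for every $D$-computable array $\{(F_{n,0},\dots,F_{n,k-1})\}_{n\in\omega}$ of $k$-tuples of mutually disjoint finite sets (given by explicit lists of their elements), with all elements of $\bigcup_{j<k}F_{n,j}$ larger than $n$ for every $n$, there is an $n^*$ such that $F_{n^*,j}\subseteq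 C^{-1}(j)$ for all $j<k$. A set is \emph{arithmetic} if it is computable in $\emptyset^{(m)}$ for some $m\in\omega$, and $\emptyset^{(\omega)}=\{\langle m,x\rangle: x\in\emptyset^{(m)}\}$. \textbf{Theorem.} $\mathsf{RT}^1_3\nleq_{soc}(\mathsf{RT}^1_2)^{<\omega}$. Moreover, there is a $\emptyset^{(\omega)}$-computable coloring $C:\omega\to 3$ which is hyperimmune relative to every arithmetic set and which witnesses this: for every $r\in\omega$ and all colorings $C_0,\dots,C_{r-1}:\omega\to 2$ there is a solution $(G_0,\dots,G_{r-1})$ to $(C_0,\dots,C_{r-1})$ that does not Turing compute any solution to $C$. -/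

import Mathlib

namespace SocRed

noncomputable section

/-- The characteristic function of a set of natural numbers. -/
def chi (A : Set ℕ) : ℕ → ℕ := by
  classical exact fun n => if n ∈ A then 1 else 0

/-- `A ≤ₜ B`: Turing reducibility between sets of natural numbers. -/
def SetTuringReducible (A B : Set ℕ) : Prop :=
  TuringReducible (fun n => Part.some (chi A n)) (fun n => Part.some (chi B n))

/-- Programs with an oracle. The constructors are those of `Nat.RecursiveIn {g}`. -/
inductive OCode : Type
  | zero : OCode
  | succ : OCode
  | left : OCode
  | right : OCode
  | oracle : OCode
  | pair : OCode → OCode → OCode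
  | comp : OCode → OCode → OCode
  | prec : OCode → OCode → OCode
  | rfind : OCode → OCode

/-- The partial function computed by a program with oracle `g`. -/
def OCode.eval (g : ℕ → ℕ) : OCode → ℕ →. ℕ
  | .zero => fun _ => Part.some 0
  | .succ => fun n => Part.some (n + 1)
  | .left => fun n => Part.some (Nat.unpair n).1
  | .right => fun n => Part.some (Nat.unpair n).2
  | .oracle => fun n => Part.some (g n)
  | .pair a b => fun n => Nat.pair <$> a.eval g n <*> b.eval g n
  | .comp a b => fun n => b.eval g n >>= a.eval g
  | .prec a b => fun p =>
      (Nat.unpair p).2.rec (a.eval g (Nat.unpair p).1) fun y IH => do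
        let i ← IH
        b.eval g (Nat.pair (Nat.unpair p).1 (Nat.pair y i))
  | .rfind a => fun n =>
      Nat.rfind fun m => (fun x => decide (x = 0)) <$> a.eval g (Nat.pair n m)

/-- The Gödel numbering of oracle programs. -/
def OCode.index : OCode → ℕ
  | .zero => 0
  | .succ => 1
  | .left => 2
  | .right => 3
  | .oracle => 4
  | .pair a b => 4 * Nat.pair a.index b.index + 5
  | .comp a b => 4 * Nat.pair a.index b.index + 6
  | .prec a b => 4 * Nat.pair a.index b.index + 7
  | .rfind a => 4 * a.index + 8

/-- The Turing jump `A'`: the indices `e` such that the `e`-th program with oracle `A` halts on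
input `e`. -/
def jump (A : Set ℕ) : Set ℕ :=
  {e | ∃ c : OCode, c.index = e ∧ (c.eval (chi A) e).Dom}

/-- The `n`-th Turing jump `∅⁽ⁿ⁾` of the empty set. -/
def emptyJump (n : ℕ) : Set ℕ := jump^[n] ∅

/-- The `ω`-jump `∅⁽ω⁾ = {⟨n, x⟩ : x ∈ ∅⁽ⁿ⁾}` of the empty set. -/
def emptyOmegaJump : Set ℕ := {p | (Nat.unpair p).2 ∈ emptyJump (Nat.unpair p).1}

/-- A set is arithmetic if it is computable in some finite jump of the empty set. -/
def IsArithmetic (D : Set ℕ) : Prop := ∃ n, SetTuringReducible D (emptyJump n)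

/-- The join `{⟨s, x⟩ : s < r, x ∈ G s}` of an `r`-tuple of sets. -/
def join {r : ℕ} (G : Fin r → Set ℕ) : Set ℕ :=
  {p | ∃ s : Fin r, (Nat.unpair p).1 = s ∧ (Nat.unpair p).2 ∈ G s}

/-- A problem: instances, and for each instance its solutions, given as sets of naturals. -/
structure Problem where
  Inst : Type
  IsSol : Inst → Set ℕ → Prop

/-- `I₁` encodes `I₀`: every solution to `I₁` Turing computes a solution to `I₀`. -/
def Encodes (P₀ P₁ : Problem) (I₀ : P₀.Inst) (I₁ : P₁.Inst) : Prop :=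
  ∀ H, P₁.IsSol I₁ H → ∃ K, P₀.IsSol I₀ K ∧ SetTuringReducible K H

/-- `P₀` is strongly omnisciently computably reducible (soc-reducible) to `P₁`. -/
def SocReducible (P₀ P₁ : Problem) : Prop :=
  ∀ I₀ : P₀.Inst, ∃ I₁ : P₁.Inst, Encodes P₀ P₁ I₀ I₁

/-- Ramsey's theorem for singletons and `k` colors: the instances are the `k`-colorings of `ℕ`,
the solutions are the infinite monochromatic sets. -/
def RT1 (k : ℕ) : Problem where
  Inst := ℕ → Fin k
  IsSol C G := G.Infinite ∧ ∃ j, ∀ x ∈ G, C x = j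

/-- `P^{<ω}`: an instance is an `r`-tuple of instances of `P` for some `r`; a solution is an
`r`-tuple of solutions (regarded as one set through its join). -/
def Problem.finPow (P : Problem) : Problem where
  Inst := Σ r : ℕ, Fin r → P.Inst
  IsSol I H := ∃ G : Fin I.1 → Set ℕ, (∀ s, P.IsSol (I.2 s) (G s)) ∧ H = join G

/-- The coloring `C` is hyperimmune relative to `D`: for every `D`-computable array of `k`-tuples
of mutually disjoint finite sets (each given by an explicit list of its elements), the `n`-th
tuple consisting of numbers larger than `n`, some tuple of the array agrees with `C`. -/
def HyperimmuneRel {k : ℕ} (C : ℕ → Fin k) (D : Set ℕ) : Prop :=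
  ∀ F : ℕ → Fin k → List ℕ,
    ComputableIn {fun n => Part.some (chi D n)} F →
    (∀ n i j, i ≠ j → List.Disjoint (F n i) (F n j)) →
    (∀ n j, ∀ x ∈ F n j, n < x) →
    ∃ n, ∀ j, ∀ x ∈ F n j, C x = j

end

end SocRed

/-! The coloring `C` is a limit of finite strings. Stage `⟨m, i⟩` runs program `i` with oracle
`∅⁽ᵐ⁾` on the current length `n`; if a tuple comes out, its elements exceed `n`, hence are
uncolored, and the string is extended to agree with it. Halting is a question to `∅⁽ᵐ⁺¹⁾`, so `∅⁽ω⁾`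
runs the construction (`exists_hyperimmuneRel_arithmetic`).

Any such `C` defeats every tuple of 2-colorings. `exists_splitting` replaces each `c s`, on an
arithmetic set, by a coloring which refines it and takes both values infinitely often on every
infinite arithmetic subset. Mathias forcing with arithmetic reservoirs then builds a set `G` of
codes `⟨s, x⟩`; each `ρ : Fin r → Bool` cuts out of `G` a solution, its side `ρ`. It suffices that,
for every assignment of a functional `Φ ρ` and a color `J ρ` to the sides, one side fails: if each
side computed a solution, the tuple of these computations would contradict this.

To force such a requirement, consider the pairs (partition `ν` of the codes, coloring `τ`) for which
no `Φ ρ`, on a finite extension of the stem respecting `ν`, outputs some `w > n` with `τ w ≠ J ρ`.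
If for every `n` some finite `τ` has no `ν`, these `τ` form an arithmetic array, so one of them
agrees with `C` above its `n`. Testing it against the true partition yields a wrong output, which is
preserved (`Cond.exists_forces_of_not_full`). Otherwise, for some `n` every `τ` has a `ν`, and
`exists_cross` gives two members of the class whose colorings are eventually different while their
partitions agree infinitely often on every column. Thinning the reservoir to places of agreement
leaves a side on which an output at a large `w` would have to satisfy both colorings, which is
impossible (`Cond.exists_forces_of_full`).

The cross-constraint theorem is where three colors beat two: a coloring can avoid two given ones at
once (`CrossPair.exists_common`), whereas two Booleans different from a third are equal
(`decides_of_forall_not_agree`). -/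

namespace SocRed

/-! ### Oracle programs: use principle, indices, jump. -/

theorem chi_of_mem {A : Set ℕ} {n : ℕ} (h : n ∈ A) : chi A n = 1 := by simp [chi, h]

theorem chi_of_notMem {A : Set ℕ} {n : ℕ} (h : n ∉ A) : chi A n = 0 := by simp [chi, h]

theorem chi_eq_one {A : Set ℕ} {n : ℕ} : chi A n = 1 ↔ n ∈ A := by
  by_cases h : n ∈ A <;> simp [chi, h]

theorem chi_congr {A B : Set ℕ} {m n : ℕ} (h : m ∈ A ↔ n ∈ B) : chi A m = chi B n := by
  by_cases h' : n ∈ B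
  · rw [chi_of_mem h', chi_of_mem (h.2 h')]
  · rw [chi_of_notMem h', chi_of_notMem (fun hm => h' (h.1 hm))]

namespace OCode

variable {g : ℕ → ℕ} {a b c : OCode} {n x y : ℕ}

theorem mem_eval_pair :
    y ∈ (OCode.pair a b).eval g n ↔ ∃ u ∈ a.eval g n, ∃ v ∈ b.eval g n, y = Nat.pair u v := by
  simp [OCode.eval, Seq.seq, eq_comm]

theorem mem_eval_comp :
    y ∈ (OCode.comp a b).eval g n ↔ ∃ u ∈ b.eval g n, y ∈ a.eval g u :=
  Part.mem_bind_iff (f := b.eval g n) (g := a.eval g)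

theorem mem_eval_rfind :
    y ∈ (OCode.rfind a).eval g n ↔ 0 ∈ a.eval g (Nat.pair n y) ∧
      ∀ m < y, ∃ v ∈ a.eval g (Nat.pair n m), v ≠ 0 := by
  refine (Nat.mem_rfind (p := fun m =>
    (a.eval g (Nat.pair n m)).map fun x => decide (x = 0))).trans ?_
  simp only [Part.mem_map_iff, decide_eq_true_eq, decide_eq_false_iff_not, ne_eq, exists_eq_right]

end OCode

/-- A value of a partial primitive recursion, expressed through its list of intermediate values. -/
theorem mem_natRec_iff_exists_list {α : Type*} (A : Part α) (B : ℕ → α → Part α) (n : ℕ) (y : α) :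
    (y ∈ (Nat.rec A (fun k IH => IH.bind (B k)) n : Part α)) ↔
      ∃ l : List α, (∃ x ∈ A, l[0]? = some x) ∧
        (∀ i < n, ∃ u v, l[i]? = some u ∧ l[i + 1]? = some v ∧ v ∈ B i u) ∧ l[n]? = some y := by
  constructor
  · intro h
    -- The exact length is added so that in the successor case the new value is appended at position
    -- `k + 1`.
    suffices H : ∃ l : List α, l.length = n + 1 ∧ (∃ x ∈ A, l[0]? = some x) ∧
        (∀ i < n, ∃ u v, l[i]? = some u ∧ l[i + 1]? = some v ∧ v ∈ B i u) ∧ l[n]? = some y by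
      obtain ⟨l, -, h⟩ := H
      exact ⟨l, h⟩
    induction n generalizing y with
    | zero => exact ⟨[y], by simp, ⟨y, h, by simp⟩, by simp, by simp⟩
    | succ k ih =>
      obtain ⟨u, hu, hy⟩ := Part.mem_bind_iff.1 h
      obtain ⟨l, hl, ⟨x, hx, h0⟩, h1, h2⟩ := ih u hu
      refine ⟨l ++ [y], by simp [hl], ⟨x, hx, ?_⟩, ?_, ?_⟩
      · rw [List.getElem?_append_left (by omega), h0]
      · intro i hi
        rcases Nat.lt_succ_iff_lt_or_eq.1 hi with hi | rfl
        · rw [List.getElem?_append_left (by omega), List.getElem?_append_left (by omega)]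
          exact h1 i hi
        · refine ⟨u, y, ?_, ?_, hy⟩
          · rw [List.getElem?_append_left (by omega), h2]
          · rw [← hl]; simp
      · rw [← hl]; simp
  · rintro ⟨l, ⟨x, hx, h0⟩, h1, h2⟩
    induction n generalizing y with
    | zero =>
      rw [h0] at h2
      simpa [← Option.some.inj h2] using hx
    | succ k ih =>
      obtain ⟨u, v, hu, hv, hB⟩ := h1 k (by omega)
      rw [hv] at h2
      obtain rfl := Option.some.inj h2
      exact Part.mem_bind_iff.2 ⟨u, ih u (fun i hi => h1 i (by omega)) hu, hB⟩

namespace OCode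

variable {g : ℕ → ℕ} {a b c : OCode} {n x y : ℕ}

theorem mem_eval_prec :
    y ∈ (OCode.prec a b).eval g n ↔ ∃ l : List ℕ,
      (∃ x ∈ a.eval g n.unpair.1, l[0]? = some x) ∧
      (∀ i < n.unpair.2, ∃ u v, l[i]? = some u ∧ l[i + 1]? = some v ∧
        v ∈ b.eval g (Nat.pair n.unpair.1 (Nat.pair i u))) ∧ l[n.unpair.2]? = some y :=
  mem_natRec_iff_exists_list (a.eval g n.unpair.1)
    (fun i u => b.eval g (Nat.pair n.unpair.1 (Nat.pair i u))) _ _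

/-- The use principle: a halting computation depends on finitely many values of the oracle. -/
theorem exists_use (c : OCode) {g : ℕ → ℕ} {n y : ℕ} (h : y ∈ c.eval g n) :
    ∃ u, ∀ g' : ℕ → ℕ, (∀ i < u, g' i = g i) → y ∈ c.eval g' n := by
  induction c generalizing n y with
  | zero => exact ⟨0, fun _ _ => h⟩
  | succ => exact ⟨0, fun _ _ => h⟩
  | left => exact ⟨0, fun _ _ => h⟩
  | right => exact ⟨0, fun _ _ => h⟩
  | oracle =>
    refine ⟨n + 1, fun g' hg' => ?_⟩
    simp only [OCode.eval, Part.mem_some_iff] at h ⊢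
    rw [h, hg' n (by omega)]
  | pair a b iha ihb =>
    obtain ⟨u, hu, v, hv, rfl⟩ := mem_eval_pair.1 h
    obtain ⟨k, hk⟩ := iha hu
    obtain ⟨l, hl⟩ := ihb hv
    exact ⟨max k l, fun g' hg' => mem_eval_pair.2
      ⟨u, hk g' fun i hi => hg' i (lt_max_of_lt_left hi), v,
        hl g' fun i hi => hg' i (lt_max_of_lt_right hi), rfl⟩⟩
  | comp a b iha ihb =>
    obtain ⟨u, hu, hy⟩ := mem_eval_comp.1 h
    obtain ⟨k, hk⟩ := ihb hu
    obtain ⟨l, hl⟩ := iha hy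
    exact ⟨max k l, fun g' hg' => mem_eval_comp.2
      ⟨u, hk g' fun i hi => hg' i (lt_max_of_lt_left hi),
        hl g' fun i hi => hg' i (lt_max_of_lt_right hi)⟩⟩
  | prec a b iha ihb =>
    obtain ⟨l, ⟨x, hx, h0⟩, h1, h2⟩ := mem_eval_prec.1 h
    obtain ⟨k, hk⟩ := iha hx
    have key : ∀ N ≤ n.unpair.2, ∃ k, ∀ g' : ℕ → ℕ, (∀ i < k, g' i = g i) → ∀ i < N,
        ∃ u v, l[i]? = some u ∧ l[i + 1]? = some v ∧
          v ∈ b.eval g' (Nat.pair n.unpair.1 (Nat.pair i u)) := by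
      intro N hN
      induction N with
      | zero => exact ⟨0, by simp⟩
      | succ N ih =>
        obtain ⟨k, hk⟩ := ih (by omega)
        obtain ⟨u, v, hu, hv, hb⟩ := h1 N (by omega)
        obtain ⟨k', hk'⟩ := ihb hb
        refine ⟨max k k', fun g' hg' i hi => ?_⟩
        rcases Nat.lt_succ_iff_lt_or_eq.1 hi with hi | rfl
        · exact hk g' (fun j hj => hg' j (lt_max_of_lt_left hj)) i hi
        · exact ⟨u, v, hu, hv, hk' g' fun j hj => hg' j (lt_max_of_lt_right hj)⟩
    obtain ⟨k', hk'⟩ := key _ le_rfl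
    exact ⟨max k k', fun g' hg' => mem_eval_prec.2
      ⟨l, ⟨x, hk g' fun i hi => hg' i (lt_max_of_lt_left hi), h0⟩,
        hk' g' fun i hi => hg' i (lt_max_of_lt_right hi), h2⟩⟩
  | rfind a iha =>
    obtain ⟨h0, h1⟩ := mem_eval_rfind.1 h
    obtain ⟨k, hk⟩ := iha h0
    have key : ∀ N ≤ y, ∃ k, ∀ g' : ℕ → ℕ, (∀ i < k, g' i = g i) → ∀ m < N,
        ∃ v ∈ a.eval g' (Nat.pair n m), v ≠ 0 := by
      intro N hN
      induction N with
      | zero => exact ⟨0, by simp⟩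
      | succ N ih =>
        obtain ⟨k, hk⟩ := ih (by omega)
        obtain ⟨v, hv, hv0⟩ := h1 N (by omega)
        obtain ⟨k', hk'⟩ := iha hv
        refine ⟨max k k', fun g' hg' i hi => ?_⟩
        rcases Nat.lt_succ_iff_lt_or_eq.1 hi with hi | rfl
        · exact hk g' (fun j hj => hg' j (lt_max_of_lt_left hj)) i hi
        · exact ⟨v, hk' g' fun j hj => hg' j (lt_max_of_lt_right hj), hv0⟩
    obtain ⟨k', hk'⟩ := key _ le_rfl
    exact ⟨max k k', fun g' hg' => mem_eval_rfind.2
      ⟨hk g' fun i hi => hg' i (lt_max_of_lt_left hi),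
        hk' g' fun i hi => hg' i (lt_max_of_lt_right hi)⟩⟩

theorem exists_eval_eq_of_recursiveIn {g : ℕ → ℕ} {f : ℕ →. ℕ}
    (h : Nat.RecursiveIn {fun n => Part.some (g n)} f) : ∃ c : OCode, c.eval g = f := by
  induction h with
  | zero => exact ⟨.zero, rfl⟩
  | succ => exact ⟨.succ, rfl⟩
  | left => exact ⟨.left, rfl⟩
  | right => exact ⟨.right, rfl⟩
  | oracle f hf =>
    obtain rfl := Set.mem_singleton_iff.1 hf
    exact ⟨.oracle, rfl⟩
  | pair _ _ iha ihb =>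
    obtain ⟨a, rfl⟩ := iha
    obtain ⟨b, rfl⟩ := ihb
    exact ⟨.pair a b, rfl⟩
  | comp _ _ iha ihb =>
    obtain ⟨a, rfl⟩ := iha
    obtain ⟨b, rfl⟩ := ihb
    exact ⟨.comp a b, rfl⟩
  | prec _ _ iha ihb =>
    obtain ⟨a, rfl⟩ := iha
    obtain ⟨b, rfl⟩ := ihb
    exact ⟨.prec a b, rfl⟩
  | rfind _ iha =>
    obtain ⟨a, rfl⟩ := iha
    exact ⟨.rfind a, rfl⟩

/-- An oracle-free computation has one program valid for all oracles at once. -/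
theorem exists_eval_eq_of_partrec {f : ℕ →. ℕ} (h : Nat.Partrec f) :
    ∃ c : OCode, ∀ g, c.eval g = f := by
  induction h with
  | zero => exact ⟨.zero, fun _ => rfl⟩
  | succ => exact ⟨.succ, fun _ => rfl⟩
  | left => exact ⟨.left, fun _ => rfl⟩
  | right => exact ⟨.right, fun _ => rfl⟩
  | pair _ _ iha ihb =>
    obtain ⟨a, ha⟩ := iha
    obtain ⟨b, hb⟩ := ihb
    exact ⟨.pair a b, fun g => by rw [OCode.eval, ha, hb]⟩
  | comp _ _ iha ihb =>
    obtain ⟨a, ha⟩ := iha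
    obtain ⟨b, hb⟩ := ihb
    exact ⟨.comp a b, fun g => by rw [OCode.eval, ha, hb]⟩
  | prec _ _ iha ihb =>
    obtain ⟨a, ha⟩ := iha
    obtain ⟨b, hb⟩ := ihb
    exact ⟨.prec a b, fun g => by rw [OCode.eval, ha, hb]⟩
  | rfind _ iha =>
    obtain ⟨a, ha⟩ := iha
    exact ⟨.rfind a, fun g => by rw [OCode.eval, ha]⟩

/-- Indices below 5 are the atoms; above, the residue mod 4 identifies the constructor and
injectivity of `Nat.pair` recovers the parts. -/
theorem index_injective : Function.Injective OCode.index := by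
  intro c d h
  induction c generalizing d with
  | zero | succ | left | right | oracle =>
    cases d <;> simp only [OCode.index] at h <;> first | rfl | omega
  | pair a b iha ihb =>
    cases d with
    | pair a' b' =>
      have h' : Nat.pair a.index b.index = Nat.pair a'.index b'.index := by
        simp only [OCode.index] at h; omega
      rw [iha (Nat.pair_eq_pair.1 h').1, ihb (Nat.pair_eq_pair.1 h').2]
    | _ => simp only [OCode.index] at h; omega
  | comp a b iha ihb =>
    cases d with
    | comp a' b' =>
      have h' : Nat.pair a.index b.index = Nat.pair a'.index b'.index := by
        simp only [OCode.index] at h; omega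
      rw [iha (Nat.pair_eq_pair.1 h').1, ihb (Nat.pair_eq_pair.1 h').2]
    | _ => simp only [OCode.index] at h; omega
  | prec a b iha ihb =>
    cases d with
    | prec a' b' =>
      have h' : Nat.pair a.index b.index = Nat.pair a'.index b'.index := by
        simp only [OCode.index] at h; omega
      rw [iha (Nat.pair_eq_pair.1 h').1, ihb (Nat.pair_eq_pair.1 h').2]
    | _ => simp only [OCode.index] at h; omega
  | rfind a iha =>
    cases d with
    | rfind a' =>
      have h' : a.index = a'.index := by
        simp only [OCode.index] at h; omega
      rw [iha h']
    | _ => simp only [OCode.index] at h; omega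

instance : Countable OCode := index_injective.countable

/-- The program with constant value `n`. -/
def const : ℕ → OCode
  | 0 => .zero
  | n + 1 => .comp .succ (const n)

theorem eval_const (g : ℕ → ℕ) (n x : ℕ) : (const n).eval g x = Part.some n := by
  induction n with
  | zero => rfl
  | succ n ih =>
    change ((const n).eval g x).bind (OCode.succ.eval g) = _
    rw [ih]
    exact Part.bind_some n _

theorem eval_comp_const (g : ℕ → ℕ) (c : OCode) (n x : ℕ) :
    (OCode.comp c (const n)).eval g x = c.eval g n := by
  change ((const n).eval g x).bind (c.eval g) = _
  rw [eval_const]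
  exact Part.bind_some n _

theorem primrec_index_const : Primrec fun n => (const n).index := by
  have h : Primrec fun n : ℕ => (Nat.rec 0 (fun _ k => 4 * Nat.pair 1 k + 6) n : ℕ) :=
    Primrec.nat_rec₁ 0 <| (Primrec.nat_add.comp (Primrec.nat_mul.comp (Primrec.const 4)
      (Primrec₂.natPair.comp (Primrec.const 1) Primrec.snd)) (Primrec.const 6)).to₂
  refine h.of_eq fun n => ?_
  induction n with
  | zero => rfl
  | succ n ih => simp only [const, OCode.index, ← ih]

theorem index_mem_jump {A : Set ℕ} : c.index ∈ jump A ↔ (c.eval (chi A) c.index).Dom :=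
  ⟨fun ⟨_, h, hd⟩ => index_injective h ▸ hd, fun h => ⟨c, rfl, h⟩⟩

/-- The composed program ignores its input, so self-halting encodes halting on an arbitrary `n`. -/
theorem index_comp_const_mem_jump {A : Set ℕ} {n : ℕ} :
    (OCode.comp c (const n)).index ∈ jump A ↔ (c.eval (chi A) n).Dom := by
  rw [index_mem_jump, eval_comp_const]

end OCode

end SocRed

/-! ### Arithmetic predicates and their closure properties. -/

namespace SocRed

variable {α β γ δ : Type*} [Primcodable α] [Primcodable β] [Primcodable γ] [Primcodable δ]

theorem primrec_id : Primrec fun a : α => a := Primrec.id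

theorem primrec_fst {f : α → β × γ} (hf : Primrec f) : Primrec fun a => (f a).1 :=
  Primrec.fst.comp hf

theorem primrec_snd {f : α → β × γ} (hf : Primrec f) : Primrec fun a => (f a).2 :=
  Primrec.snd.comp hf

theorem primrec_unpair_fst {f : α → ℕ} (hf : Primrec f) : Primrec fun a => (f a).unpair.1 :=
  Primrec.fst.comp (Primrec.unpair.comp hf)

theorem primrec_unpair_snd {f : α → ℕ} (hf : Primrec f) : Primrec fun a => (f a).unpair.2 :=
  Primrec.snd.comp (Primrec.unpair.comp hf)

theorem primrec_natPair {f g : α → ℕ} (hf : Primrec f) (hg : Primrec g) :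
    Primrec fun a => Nat.pair (f a) (g a) := Primrec₂.natPair.comp hf hg

theorem primrec_add {f g : α → ℕ} (hf : Primrec f) (hg : Primrec g) :
    Primrec fun a => f a + g a := Primrec.nat_add.comp hf hg

theorem primrec_mul {f g : α → ℕ} (hf : Primrec f) (hg : Primrec g) :
    Primrec fun a => f a * g a := Primrec.nat_mul.comp hf hg

theorem primrec_sub {f g : α → ℕ} (hf : Primrec f) (hg : Primrec g) :
    Primrec fun a => f a - g a := Primrec.nat_sub.comp hf hg

theorem primrec_some {f : α → β} (hf : Primrec f) : Primrec fun a => some (f a) :=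
  Primrec.option_some.comp hf

theorem primrec_getElem? {f : α → List β} {g : α → ℕ} (hf : Primrec f) (hg : Primrec g) :
    Primrec fun a => (f a)[g a]? := Primrec.list_getElem?.comp hf hg

theorem primrec_append {f g : α → List β} (hf : Primrec f) (hg : Primrec g) :
    Primrec fun a => f a ++ g a := Primrec.list_append.comp hf hg

theorem primrec_length {f : α → List β} (hf : Primrec f) : Primrec fun a => (f a).length :=
  Primrec.list_length.comp hf

theorem primrec_encode {f : α → β} (hf : Primrec f) : Primrec fun a => Encodable.encode (f a) :=
  Primrec.encode.comp hf

theorem primrec_index_const {f : α → ℕ} (hf : Primrec f) :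
    Primrec fun a => (OCode.const (f a)).index := OCode.primrec_index_const.comp hf

/-- Primitive recursiveness of explicit terms, proved by the default tactic. -/
theorem primrec_auto {f : α → β} (hf : Primrec f := by
    with_reducible
      repeat' first
        | exact Primrec.const _
        | exact primrec_id
        | apply primrec_unpair_fst
        | apply primrec_unpair_snd
        | apply primrec_fst
        | apply primrec_snd
        | apply Primrec.pair
        | apply primrec_natPair
        | apply primrec_add
        | apply primrec_mul
        | apply primrec_sub
        | apply primrec_some
        | apply primrec_getElem?
        | apply primrec_append
        | apply primrec_length
        | apply primrec_encode
        | apply primrec_index_const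
        | assumption) : Primrec f := hf

theorem SetTuringReducible.refl (A : Set ℕ) : SetTuringReducible A A := TuringReducible.refl _

theorem SetTuringReducible.trans {A B C : Set ℕ} (h : SetTuringReducible A B)
    (h' : SetTuringReducible B C) : SetTuringReducible A C := TuringReducible.trans h h'

theorem setTuringReducible_iff {A B : Set ℕ} : SetTuringReducible A B ↔
    Nat.RecursiveIn {fun n => Part.some (chi B n)} fun n => Part.some (chi A n) :=
  RecursiveIn.iff_nat

theorem SetTuringReducible.exists_eval {A B : Set ℕ} (h : SetTuringReducible A B) :
    ∃ c : OCode, ∀ n, c.eval (chi B) n = Part.some (chi A n) := by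
  obtain ⟨c, hc⟩ := OCode.exists_eval_eq_of_recursiveIn (setTuringReducible_iff.1 h)
  exact ⟨c, fun n => by rw [hc]⟩

theorem recursiveIn_comp_primrec {O : Set (ℕ →. ℕ)} {f g : ℕ → ℕ}
    (hf : Nat.RecursiveIn O fun n => Part.some (f n)) (hg : Primrec g) :
    Nat.RecursiveIn O fun n => Part.some (f (g n)) :=
  (hf.comp (Primrec.nat_iff.1 hg).recursiveIn).of_eq fun n => Part.bind_some (g n) _

theorem recursiveIn_primrec_comp {O : Set (ℕ →. ℕ)} {f g : ℕ → ℕ}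
    (hf : Primrec f) (hg : Nat.RecursiveIn O fun n => Part.some (g n)) :
    Nat.RecursiveIn O fun n => Part.some (f (g n)) :=
  ((Primrec.nat_iff.1 hf).recursiveIn.comp hg).of_eq fun n => Part.bind_some (g n) _

theorem recursiveIn_natPair {O : Set (ℕ →. ℕ)} {f g : ℕ → ℕ}
    (hf : Nat.RecursiveIn O fun n => Part.some (f n))
    (hg : Nat.RecursiveIn O fun n => Part.some (g n)) :
    Nat.RecursiveIn O fun n => Part.some (Nat.pair (f n) (g n)) :=
  (hf.pair hg).of_eq fun n => by simp [Seq.seq]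

theorem setTuringReducible_preimage (A : Set ℕ) {f : ℕ → ℕ} (hf : Primrec f) :
    SetTuringReducible (f ⁻¹' A) A :=
  setTuringReducible_iff.2 <|
    (recursiveIn_comp_primrec (setTuringReducible_iff.1 (.refl A)) hf).of_eq fun _ =>
      congrArg Part.some (chi_congr Iff.rfl)

theorem setTuringReducible_compl (A : Set ℕ) : SetTuringReducible Aᶜ A :=
  setTuringReducible_iff.2 <|
    (recursiveIn_primrec_comp (f := fun n => 1 - n)
      primrec_auto
      (setTuringReducible_iff.1 (.refl A))).of_eq fun n => by
        by_cases h : n ∈ A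
        · rw [chi_of_mem h, chi_of_notMem (by simpa using h)]
        · rw [chi_of_notMem h, chi_of_mem (by simpa using h)]

theorem SetTuringReducible.inter {A B C : Set ℕ} (hA : SetTuringReducible A C)
    (hB : SetTuringReducible B C) : SetTuringReducible (A ∩ B) C :=
  setTuringReducible_iff.2 <|
    (recursiveIn_primrec_comp (f := fun n => n.unpair.1 * n.unpair.2) primrec_auto
      (recursiveIn_natPair (setTuringReducible_iff.1 hA) (setTuringReducible_iff.1 hB))).of_eq
      fun n => by
        by_cases h : n ∈ A <;> by_cases h' : n ∈ B <;> simp [chi, h, h']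

theorem setTuringReducible_of_primrecPred {A B : Set ℕ} (h : PrimrecPred (· ∈ A)) :
    SetTuringReducible A B := by
  obtain ⟨_, h⟩ := h
  refine setTuringReducible_iff.2 ((Primrec.nat_iff.1 ((Primrec.dom_bool fun b : Bool =>
    if b then 1 else 0).comp h)).recursiveIn.of_eq fun n => ?_)
  by_cases h' : n ∈ A
  · rw [chi_of_mem h']; simp [h']
  · rw [chi_of_notMem h']; simp [h']

/-- Unbounded search for a witness halts exactly when one exists. The search runs on the complement
of `D` because `rfind` stops at the value 0. -/
theorem SetTuringReducible.exists_jump {A D : Set ℕ} (h : SetTuringReducible D A) :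
    SetTuringReducible {x | ∃ y, Nat.pair x y ∈ D} (jump A) := by
  obtain ⟨c, hc⟩ := ((setTuringReducible_compl D).trans h).exists_eval
  have key : {x | ∃ y, Nat.pair x y ∈ D} =
      (fun x => (OCode.comp (.rfind c) (.const x)).index) ⁻¹' jump A := by
    ext x
    rw [Set.mem_preimage, OCode.index_comp_const_mem_jump, Part.dom_iff_mem]
    simp only [OCode.mem_eval_rfind, hc, Part.mem_some_iff]
    constructor
    · intro hx
      classical
      refine ⟨Nat.find hx, ?_, fun m hm => ⟨_, rfl, ?_⟩⟩
      · rw [chi_of_notMem]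
        simpa using Nat.find_spec hx
      · rw [chi_of_mem]
        · simp
        · exact Nat.find_min hx hm
    · rintro ⟨y, hy, -⟩
      refine ⟨y, ?_⟩
      by_contra hn
      rw [chi_of_mem (by simpa using hn)] at hy
      omega
  rw [key]
  refine setTuringReducible_preimage _ ?_
  simp only [OCode.index]
  exact primrec_auto

theorem setTuringReducible_jump (A : Set ℕ) : SetTuringReducible A (jump A) := by
  have h := (setTuringReducible_preimage A (f := fun n => n.unpair.1) primrec_auto).exists_jump
  simpa using h

theorem emptyJump_succ (n : ℕ) : emptyJump (n + 1) = jump (emptyJump n) :=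
  Function.iterate_succ_apply' jump n ∅

theorem emptyJump_mono {m n : ℕ} (h : m ≤ n) :
    SetTuringReducible (emptyJump m) (emptyJump n) := by
  induction n, h using Nat.le_induction with
  | base => exact .refl _
  | succ n _ ih => exact ih.trans (emptyJump_succ n ▸ setTuringReducible_jump _)

theorem IsArithmetic.of_reducible {A B : Set ℕ} (hB : IsArithmetic B)
    (h : SetTuringReducible A B) : IsArithmetic A := by
  obtain ⟨n, hn⟩ := hB
  exact ⟨n, h.trans hn⟩

theorem IsArithmetic.inter {A B : Set ℕ} (hA : IsArithmetic A) (hB : IsArithmetic B) :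
    IsArithmetic (A ∩ B) := by
  obtain ⟨m, hm⟩ := hA
  obtain ⟨n, hn⟩ := hB
  exact ⟨max m n, (hm.trans (emptyJump_mono (le_max_left m n))).inter
    (hn.trans (emptyJump_mono (le_max_right m n)))⟩

theorem IsArithmetic.proj {D : Set ℕ} (hD : IsArithmetic D) :
    IsArithmetic {x | ∃ y, Nat.pair x y ∈ D} := by
  obtain ⟨n, hn⟩ := hD
  exact ⟨n + 1, emptyJump_succ n ▸ hn.exists_jump⟩

/-- A predicate is arithmetic if it is given, on codes, by an arithmetic set. -/
def Arith (p : α → Prop) : Prop := ∃ D, IsArithmetic D ∧ ∀ a, p a ↔ Encodable.encode a ∈ D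

namespace Arith

variable {p q : α → Prop}

theorem congr (hp : Arith p) (h : ∀ a, q a ↔ p a) : Arith q := by
  rwa [show q = p from funext fun a => propext (h a)]

theorem of_primrecPred (h : PrimrecPred p) : Arith p := by
  refine ⟨{n | ∃ a, Encodable.decode n = some a ∧ p a}, ⟨0, setTuringReducible_of_primrecPred ?_⟩,
    fun a => by simp⟩
  obtain ⟨_, h⟩ := h
  have h' : Primrec fun n : ℕ => ((Encodable.decode n : Option α).map fun a => decide (p a)) :=
    Primrec.option_map Primrec.decode (h.comp Primrec.snd).to₂
  refine (Primrec.eq.comp h' (Primrec.const (some true))).of_eq fun n => ?_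
  simp [Option.map_eq_some_iff]

theorem comp {f : β → α} (hp : Arith p) (hf : Primrec f) : Arith fun b => p (f b) := by
  obtain ⟨D, hD, h⟩ := hp
  have hf' : Primrec fun n : ℕ => ((Encodable.decode n : Option β).map
      fun b => Encodable.encode (f b)).getD 0 :=
    Primrec.option_getD.comp (Primrec.option_map Primrec.decode
      ((Primrec.encode.comp hf).comp Primrec.snd).to₂) (Primrec.const 0)
  exact ⟨_, hD.of_reducible (setTuringReducible_preimage D hf'), fun b => by simp [h]⟩

theorem comp₂ {p : α → β → Prop} (hp : Arith fun t : α × β => p t.1 t.2) {f : γ → α} {g : γ → β}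
    (hf : Primrec f := by exact primrec_auto) (hg : Primrec g := by exact primrec_auto) :
    Arith fun c => p (f c) (g c) :=
  hp.comp (f := fun c => (f c, g c)) primrec_auto

theorem comp₃ {p : α → β → γ → Prop} (hp : Arith fun t : α × β × γ => p t.1 t.2.1 t.2.2)
    {f : δ → α} {g : δ → β} {h : δ → γ}
    (hf : Primrec f := by exact primrec_auto) (hg : Primrec g := by exact primrec_auto)
    (hh : Primrec h := by exact primrec_auto) :
    Arith fun d => p (f d) (g d) (h d) :=
  hp.comp (f := fun d => (f d, g d, h d)) primrec_auto

theorem not (hp : Arith p) : Arith fun a => ¬ p a := by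
  obtain ⟨D, hD, h⟩ := hp
  exact ⟨_, hD.of_reducible (setTuringReducible_compl D), fun a => by simp [h]⟩

theorem and (hp : Arith p) (hq : Arith q) : Arith fun a => p a ∧ q a := by
  obtain ⟨D, hD, h⟩ := hp
  obtain ⟨E, hE, h'⟩ := hq
  exact ⟨_, hD.inter hE, fun a => by simp [h, h']⟩

theorem or (hp : Arith p) (hq : Arith q) : Arith fun a => p a ∨ q a :=
  (hp.not.and hq.not).not.congr fun a => by tauto

theorem imp (hp : Arith p) (hq : Arith q) : Arith fun a => p a → q a :=
  (hp.and hq.not).not.congr fun a => by tauto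

theorem ex {p : α → β → Prop} (hp : Arith fun x : α × β => p x.1 x.2) :
    Arith fun a => ∃ b, p a b := by
  obtain ⟨D, hD, h⟩ := hp
  -- Projection ranges over all naturals and `D` is only controlled on codes, so the witness must
  -- also be required to code an element of `β`.
  have hV : PrimrecPred fun n : ℕ => n.unpair.2 ∈ Set.range (Encodable.encode : β → ℕ) :=
    PrimrecPred.comp Primcodable.mem_range_encode (f := fun n : ℕ => n.unpair.2) primrec_auto
  have hV' : IsArithmetic {n : ℕ | n.unpair.2 ∈ Set.range (Encodable.encode : β → ℕ)} :=
    ⟨0, setTuringReducible_of_primrecPred hV⟩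
  refine ⟨_, (hD.inter hV').proj, fun a => ⟨?_, ?_⟩⟩
  · rintro ⟨b, hb⟩
    exact ⟨Encodable.encode b, (h (a, b)).1 hb, by simp⟩
  · rintro ⟨m, hm, hm'⟩
    obtain ⟨b, hb⟩ : ∃ b : β, Encodable.encode b = m := by simpa using hm'
    exact ⟨b, (h (a, b)).2 (by rw [Encodable.encode_prod_val, hb]; exact hm)⟩

theorem all {p : α → β → Prop} (hp : Arith fun x : α × β => p x.1 x.2) :
    Arith fun a => ∀ b, p a b :=
  (Arith.ex (p := fun a b => ¬ p a b) hp.not).not.congr fun a => by simp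

theorem eq {f g : α → β} (hf : Primrec f := by exact primrec_auto)
    (hg : Primrec g := by exact primrec_auto) : Arith fun a => f a = g a :=
  of_primrecPred (Primrec.eq.comp hf hg)

theorem lt {f g : α → ℕ} (hf : Primrec f := by exact primrec_auto)
    (hg : Primrec g := by exact primrec_auto) : Arith fun a => f a < g a :=
  of_primrecPred (Primrec.nat_lt.comp hf hg)

theorem le {f g : α → ℕ} (hf : Primrec f := by exact primrec_auto)
    (hg : Primrec g := by exact primrec_auto) : Arith fun a => f a ≤ g a :=
  of_primrecPred (Primrec.nat_le.comp hf hg)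

theorem const (P : Prop) : Arith fun _ : α => P := by
  by_cases h : P
  · exact (eq (α := α) (f := fun _ => 0) (g := fun _ => 0)).congr fun _ => by simp [h]
  · exact (eq (α := α) (f := fun _ => 0) (g := fun _ => 1)).congr fun _ => by simp [h]

theorem mem {f : α → List β} {g : α → β} (hf : Primrec f := by exact primrec_auto)
    (hg : Primrec g := by exact primrec_auto) :
    Arith fun a => g a ∈ f a :=
  (Arith.ex (p := fun a i => (f a)[i]? = some (g a))
    (.eq (primrec_getElem? (hf.comp Primrec.fst) Primrec.snd)
      (primrec_some (hg.comp Primrec.fst)))).congr fun _ => List.mem_iff_getElem?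

theorem isPrefix {f g : α → List β} (hf : Primrec f := by exact primrec_auto)
    (hg : Primrec g := by exact primrec_auto) :
    Arith fun a => f a <+: g a :=
  Arith.ex (p := fun a t => f a ++ t = g a)
    (.eq (primrec_append (hf.comp Primrec.fst) Primrec.snd) (hg.comp Primrec.fst))

theorem forall_finite {ι : Type*} [Finite ι] {p : ι → α → Prop} (hp : ∀ i, Arith (p i)) :
    Arith fun a => ∀ i, p i a := by
  have := Fintype.ofFinite ι
  suffices h : ∀ s : Finset ι, Arith fun a => ∀ i ∈ s, p i a from
    (h Finset.univ).congr fun _ => by simp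
  classical
  intro s
  induction s using Finset.induction_on with
  | empty => exact (const True).congr fun a => by simp
  | insert i s _ ih => exact ((hp i).and ih).congr fun a => by simp

theorem exists_finite {ι : Type*} [Finite ι] {p : ι → α → Prop} (hp : ∀ i, Arith (p i)) :
    Arith fun a => ∃ i, p i a :=
  (forall_finite fun i => (hp i).not).not.congr fun a => by simp

/-- For every program `c`, the relation `y ∈ c(x)` with finite oracle `E` is arithmetic. -/
theorem mem_eval (c : OCode) :
    Arith fun t : List ℕ × ℕ × ℕ => t.2.2 ∈ c.eval (chi {p | p ∈ t.1}) t.2.1 := by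
  induction c with
  | zero =>
    exact (eq (f := fun t : List ℕ × ℕ × ℕ => t.2.2) (g := fun _ => 0)).congr
      fun t => by simp [OCode.eval]
  | succ =>
    exact (eq (f := fun t : List ℕ × ℕ × ℕ => t.2.2) (g := fun t => t.2.1 + 1)).congr
      fun t => by simp [OCode.eval]
  | left =>
    exact (eq (f := fun t : List ℕ × ℕ × ℕ => t.2.2) (g := fun t => t.2.1.unpair.1)).congr
      fun t => by simp [OCode.eval]
  | right =>
    exact (eq (f := fun t : List ℕ × ℕ × ℕ => t.2.2) (g := fun t => t.2.1.unpair.2)).congr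
      fun t => by simp [OCode.eval]
  | oracle =>
    have hm := mem (f := fun t : List ℕ × ℕ × ℕ => t.1) (g := fun t => t.2.1)
    have he (k : ℕ) := eq (f := fun t : List ℕ × ℕ × ℕ => t.2.2) (g := fun _ => k)
    refine ((hm.and (he 1)).or (hm.not.and (he 0))).congr fun t => ?_
    by_cases h : t.2.1 ∈ t.1 <;> simp [OCode.eval, chi, h]
  | pair a b iha ihb =>
    refine congr ?_ fun t => OCode.mem_eval_pair
    refine .ex <| .and (.comp₃ (p := fun E x y => y ∈ OCode.eval (chi {p | p ∈ E}) a x) iha) <|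
      .ex <| .and (.comp₃ (p := fun E x y => y ∈ OCode.eval (chi {p | p ∈ E}) b x) ihb) <| .eq
  | comp a b iha ihb =>
    refine congr ?_ fun t => OCode.mem_eval_comp
    refine .ex <| .and (.comp₃ (p := fun E x y => y ∈ OCode.eval (chi {p | p ∈ E}) b x) ihb)
      (.comp₃ (p := fun E x y => y ∈ OCode.eval (chi {p | p ∈ E}) a x) iha)
  | prec a b iha ihb =>
    refine congr ?_ fun t => OCode.mem_eval_prec
    refine .ex <| .and (.ex <| .and
      (.comp₃ (p := fun E x y => y ∈ OCode.eval (chi {p | p ∈ E}) a x) iha) <| .eq) <| .and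
      (.all <| .imp .lt <| .ex <| .ex <| .and .eq <| .and .eq <|
        (.comp₃ (p := fun E x y => y ∈ OCode.eval (chi {p | p ∈ E}) b x) ihb)) <| .eq
  | rfind a iha =>
    refine congr ?_ fun t => OCode.mem_eval_rfind
    refine .and (.comp₃ (p := fun E x y => y ∈ OCode.eval (chi {p | p ∈ E}) a x) iha) <|
      .all <| .imp .lt <| .ex <| .and
        (.comp₃ (p := fun E x y => y ∈ OCode.eval (chi {p | p ∈ E}) a x) iha) <|
        .not <| .eq

/-- Sequences defined by recursion from an arithmetic relation are arithmetic. -/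
theorem iterate {s : ℕ → α} {R : ℕ → α → α → Prop}
    (hR : Arith fun t : ℕ × α × α => R t.1 t.2.1 t.2.2)
    (hs : ∀ k b, R k (s k) b ↔ b = s (k + 1)) : Arith fun t : ℕ × α => t.2 = s t.1 := by
  refine congr (p := fun t : ℕ × α => ∃ l : List α, l[0]? = some (s 0) ∧
    (∀ i, i < t.1 → ∃ u v, l[i]? = some u ∧ l[i + 1]? = some v ∧ R i u v) ∧
      l[t.1]? = some t.2) ?_ fun t => ?_
  · refine .ex <| .and .eq <| .and (.all <| .imp .lt <| .ex <| .ex <|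
      .and .eq <| .and .eq <|
        .comp₃ (p := R) hR) <| .eq
  · have h := mem_natRec_iff_exists_list (Part.some (s 0)) (fun k _ => Part.some (s (k + 1)))
      t.1 t.2
    have h' : (Nat.rec (Part.some (s 0)) (fun k IH => IH.bind fun _ => Part.some (s (k + 1)))
        t.1 : Part α) = Part.some (s t.1) := by
      induction t.1 with
      | zero => rfl
      | succ k ih => simp only [ih, Part.bind_some]
    rw [h', Part.mem_some_iff] at h
    constructor
    · intro ht
      refine ⟨(List.range (t.1 + 1)).map s, by simp, fun i hi => ⟨s i, s (i + 1), ?_, ?_, ?_⟩, ?_⟩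
      · simp [List.getElem?_range (show i < t.1 + 1 by omega)]
      · simp [List.getElem?_range (show i + 1 < t.1 + 1 by omega)]
      · exact (hs _ _).2 rfl
      · simp [ht]
    · rintro ⟨l, h0, h1, h2⟩
      have : ∀ i ≤ t.1, l[i]? = some (s i) := by
        intro i
        induction i with
        | zero => exact fun _ => h0
        | succ i ih =>
          intro hi
          obtain ⟨u, v, hu, hv, hR⟩ := h1 i (by omega)
          obtain rfl : s i = u := Option.some.inj ((ih (by omega)).symm.trans hu)
          rw [hv, (hs _ _).1 hR]
      exact Option.some.inj (h2.symm.trans (this _ le_rfl))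

/-- An arithmetic relation is uniformized by a function with arithmetic graph. -/
theorem exists_choice {p : α → β → Prop} (hp : Arith fun t : α × β => p t.1 t.2)
    (h : ∀ a, ∃ b, p a b) : ∃ f : α → β, (∀ a, p a (f a)) ∧ Arith fun t : α × β => t.2 = f t.1 := by
  -- The witness of least code is definable from `p` by one more quantifier.
  have h' : ∀ a, ∃ b, p a b ∧ ∀ b', p a b' → Encodable.encode b ≤ Encodable.encode b' := by
    intro a
    obtain ⟨b, hb, hmin⟩ := WellFounded.has_min (measure (Encodable.encode : β → ℕ)).wf
      {b | p a b} (h a)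
    exact ⟨b, hb, fun b' hb' => not_lt.1 (hmin b' hb')⟩
  choose f hf hmin using h'
  refine ⟨f, hf, congr (p := fun t : α × β => p t.1 t.2 ∧ ∀ b', p t.1 b' →
    Encodable.encode t.2 ≤ Encodable.encode b')
    (.and hp <| .all <| .imp (.comp₂ (p := p) hp) .le) ?_⟩
  rintro ⟨a, b⟩
  refine ⟨?_, fun ⟨hb, hb'⟩ => ?_⟩
  · intro h
    obtain rfl : b = f a := h
    exact ⟨hf a, hmin a⟩
  · exact Encodable.encode_injective (le_antisymm (hb' _ (hf a)) (hmin a b hb))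

/-- Dependent choices along an arithmetic relation can be made arithmetically. -/
theorem exists_seq {Q : ℕ → α → α → Prop} (hQ : Arith fun t : ℕ × α × α => Q t.1 t.2.1 t.2.2)
    {S : α → Prop} {a₀ : α} (h₀ : S a₀) (hS : ∀ k a, S a → ∃ b, Q k a b)
    (hS' : ∀ k a b, S a → Q k a b → S b) :
    ∃ s : ℕ → α, s 0 = a₀ ∧ (∀ k, S (s k)) ∧ (∀ k, Q k (s k) (s (k + 1))) ∧
      Arith fun t : ℕ × α => t.2 = s t.1 := by
  obtain ⟨f, hf, hfa⟩ := exists_choice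
    -- The implication makes the relation total, so that a choice function exists even at states
    -- outside `S`.
    (p := fun (t : ℕ × α) b => (∃ b', Q t.1 t.2 b') → Q t.1 t.2 b)
    (.imp (.ex <| .comp₃ (p := Q) hQ) (.comp₃ (p := Q) hQ)) fun t => by
      by_cases h : ∃ b', Q t.1 t.2 b'
      · obtain ⟨b, hb⟩ := h
        exact ⟨b, fun _ => hb⟩
      · exact ⟨t.2, fun h' => (h h').elim⟩
  let s : ℕ → α := fun n => Nat.rec a₀ (fun k a => f (k, a)) n
  have hs : ∀ k, S (s k) := fun k => by
    induction k with
    | zero => exact h₀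
    | succ k ih => exact hS' k _ _ ih (hf (k, s k) (hS k _ ih))
  exact ⟨s, rfl, hs, fun k => hf (k, s k) (hS k _ (hs k)),
    iterate (R := fun k a b => b = f (k, a))
      (.comp₂ (p := fun t b => b = f t) hfa) fun k b => Iff.rfl⟩

/-- A function with arithmetic graph is computable in some arithmetic set. -/
theorem exists_computableIn {F : ℕ → α} (hF : Arith fun t : ℕ × α => t.2 = F t.1) :
    ∃ D, IsArithmetic D ∧ ComputableIn {fun n => Part.some (chi D n)} F := by
  -- `D` is the complement of the graph on codes, so `rfind` on its characteristic function stops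
  -- exactly at the value.
  obtain ⟨D, hD, h⟩ := (Arith.ex (p := fun (n : ℕ) (a : α) =>
    a = F n.unpair.1 ∧ n.unpair.2 = Encodable.encode a) <| .and
      (.comp₂ (p := fun n a => a = F n) hF)
      .eq).not
  refine ⟨D, hD, ?_⟩
  have hO : Nat.RecursiveIn {fun n => Part.some (chi D n)} fun n => Part.some (chi D n) :=
    .oracle _ rfl
  refine hO.rfind.of_eq fun n => Eq.trans (b := Part.some (Encodable.encode (F n)))
    (Part.eq_some_iff.2 ?_) (by simp)
  have key : ∀ m, Nat.pair n m ∈ D ↔ m ≠ Encodable.encode (F n) := fun m => by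
    simpa using (h (Nat.pair n m)).symm
  refine Nat.mem_rfind.2 ?_
  simp only [Part.map_eq_map, Part.map_some, Part.mem_some_iff]
  refine ⟨?_, fun hm => ?_⟩
  · rw [chi_of_notMem (by simp [key])]; simp
  · rw [chi_of_mem ((key _).2 (by simpa using hm.ne))]; simp

end Arith

end SocRed

/-! ### Combinatorics of cross pairs. -/

namespace SocRed

theorem getElem?_of_isPrefix {α : Type*} {l l' : List α} (h : l <+: l') {i : ℕ} {a : α}
    (hi : l[i]? = some a) : l'[i]? = some a := by
  obtain ⟨t, rfl⟩ := h
  rw [List.getElem?_append_left (List.getElem?_eq_some_iff.1 hi).1, hi]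

theorem exists_isPrefix_of_le {α : Type*} (l : List α) (f : ℕ → α) {n : ℕ} (h : l.length ≤ n) :
    ∃ l', l <+: l' ∧ l'.length = n ∧ ∀ i, l.length ≤ i → i < n → l'[i]? = some (f i) := by
  refine ⟨l ++ (List.range (n - l.length)).map fun i => f (i + l.length), List.prefix_append _ _,
    by simp; omega, fun i hi hn => ?_⟩
  rw [List.getElem?_append_right hi, List.getElem?_map, List.getElem?_range (by omega)]
  simp [hi]

/-- A pair of a partial instance and a partial coloring. -/
abbrev Pre := List Bool × List (Fin 3)

/-- Above `c`, every coloring extends to a member of the class given by the tree `T`. -/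
def Full (T : List Bool → List (Fin 3) → Prop) (c : Pre) : Prop :=
  ∀ τ, c.2 <+: τ → c.1.length ≤ τ.length → ∃ ν, c.1 <+: ν ∧ ν.length = τ.length ∧ T ν τ

/-- The tree `T` is closed under initial segments. -/
def PrefixClosed (T : List Bool → List (Fin 3) → Prop) : Prop :=
  ∀ ν τ ν' τ', T ν τ → ν' <+: ν → τ' <+: τ → ν'.length = τ'.length → T ν' τ'

/-- The coordinatewise extension order. -/
def Pre.Le (c d : Pre) : Prop := c.1 <+: d.1 ∧ c.2 <+: d.2

theorem Pre.Le.refl (c : Pre) : c.Le c := ⟨List.prefix_rfl, List.prefix_rfl⟩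

theorem Pre.Le.trans {c d e : Pre} (h : c.Le d) (h' : d.Le e) : c.Le e :=
  ⟨h.1.trans h'.1, h.2.trans h'.2⟩

/-- The colorings differ at every place from `N` on. -/
def DisjFrom (N : ℕ) (σ τ : List (Fin 3)) : Prop :=
  ∀ w, N ≤ w → ∀ c, σ[w]? = some c → τ[w]? ≠ some c

/-- Two extendible conditions whose colorings have the same length and differ from `N` on. -/
structure CrossPair (T : List Bool → List (Fin 3) → Prop) (N : ℕ) (q : Pre × Pre) : Prop where
  left : Full T q.1
  right : Full T q.2
  length_eq : q.1.2.length = q.2.2.length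
  disj : DisjFrom N q.1.2 q.2.2

/-- The two instances take a common value at some place of `S` from `k` on. -/
def Agree (S : Set ℕ) (k : ℕ) (q : Pre × Pre) : Prop :=
  ∃ x, k ≤ x ∧ x ∈ S ∧ ∃ b, q.1.1[x]? = some b ∧ q.2.1[x]? = some b

variable {T : List Bool → List (Fin 3) → Prop} {N k : ℕ} {c d : Pre} {q : Pre × Pre}

theorem Agree.mono {S : Set ℕ} {q' : Pre × Pre} (h : Agree S k q) (h₁ : q.1.Le q'.1)
    (h₂ : q.2.Le q'.2) : Agree S k q' := by
  obtain ⟨x, hk, hx, b, hb, hb'⟩ := h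
  exact ⟨x, hk, hx, b, getElem?_of_isPrefix h₁.1 hb, getElem?_of_isPrefix h₂.1 hb'⟩

theorem Full.mono_right {μ : List Bool} {σ σ' : List (Fin 3)} (h : Full T (μ, σ))
    (hσ : σ <+: σ') : Full T (μ, σ') := fun τ hτ hl => h τ (hσ.trans hτ) hl

/-- If `false` fails at `τ₁` and `true` fails at some `τ₂` extending `τ₁`, then a `ν` for `τ₂` has
no possible next bit: truncating it to the length of `τ₁` excludes `false`. -/
theorem Full.exists_concat (hT : PrefixClosed T) {μ : List Bool} {σ : List (Fin 3)}
    (h : Full T (μ, σ)) : ∃ b σ', σ <+: σ' ∧ Full T (μ ++ [b], σ') := by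
  by_contra! hn
  have h₁ := hn false σ List.prefix_rfl
  simp only [Full, not_forall] at h₁
  obtain ⟨τ₁, hσ₁, hl₁, h₁⟩ := h₁
  have h₂ := hn true τ₁ hσ₁
  simp only [Full, not_forall] at h₂
  obtain ⟨τ₂, hσ₂, hl₂, h₂⟩ := h₂
  simp only [List.length_append, List.length_singleton] at hl₁ hl₂
  obtain ⟨ν, hμν, hν, hTν⟩ := h τ₂ (hσ₁.trans hσ₂) (show μ.length ≤ _ by omega)
  obtain ⟨t, rfl⟩ := hμν
  have hle := hσ₂.length_le
  simp only at hν hTν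
  rcases t with _ | ⟨b, t⟩
  · simp at hν; omega
  · have hp : μ ++ [b] <+: μ ++ b :: t := ⟨t, by simp⟩
    cases b
    · refine h₁ ⟨(μ ++ false :: t).take τ₁.length, ?_, ?_, ?_⟩
      · exact List.prefix_take_iff.2 ⟨hp, by simpa using hl₁⟩
      · simp only [List.length_take]; omega
      · exact hT _ _ _ _ hTν (List.take_prefix _ _) hσ₂ (by simp only [List.length_take]; omega)
    · exact h₂ ⟨_, hp, hν, hTν⟩

theorem Full.exists_le_length (hT : PrefixClosed T) (h : Full T c) (k : ℕ) :
    ∃ d, c.Le d ∧ k ≤ d.1.length ∧ Full T d := by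
  induction k with
  | zero => exact ⟨c, .refl c, Nat.zero_le _, h⟩
  | succ k ih =>
    obtain ⟨⟨μ, σ⟩, hc, hk, hd⟩ := ih
    obtain ⟨b, σ', hσ, hd'⟩ := hd.exists_concat hT
    exact ⟨(μ ++ [b], σ'), hc.trans ⟨List.prefix_append _ _, hσ⟩,
      by simpa using hk, hd'⟩

theorem Full.take (hT : PrefixClosed T) (h : Full T c) (h₁ : k ≤ c.1.length)
    (h₂ : k ≤ c.2.length) : T (c.1.take k) (c.2.take k) := by
  obtain ⟨τ, hτ, hl, -⟩ := exists_isPrefix_of_le c.2 (fun _ => 0)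
    (le_max_right c.1.length c.2.length)
  obtain ⟨ν, hν, hl', hTν⟩ := h τ hτ (by omega)
  exact hT _ _ _ _ hTν ((List.take_prefix _ _).trans hν) ((List.take_prefix _ _).trans hτ)
    (by simp [h₁, h₂])

/-- Two arbitrary extensions of the left half can be crossed with one and the same extension of the
right half. The new right coloring avoids both left colorings up to length `L`; lengthening its
instance may prolong it uncontrollably to `ρ`, after which each left coloring is prolonged avoiding
`ρ`. -/
theorem CrossPair.exists_common (hT : PrefixClosed T) (h : CrossPair T N (c, d)) {c' c'' : Pre}
    (hc' : c.Le c') (hF' : Full T c') (hc'' : c.Le c'') (hF'' : Full T c'') (k : ℕ) :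
    ∃ e' e'' e, c'.Le e' ∧ c''.Le e'' ∧ d.Le e ∧ CrossPair T N (e', e) ∧ CrossPair T N (e'', e) ∧
      k ≤ e.1.length ∧ k ≤ e.2.length := by
  obtain ⟨hFc, hFd, hlen, hdisj⟩ := h
  have hl' := hc'.2.length_le
  have hl'' := hc''.2.length_le
  set L := max (max c'.2.length c''.2.length) k with hL
  obtain ⟨τ', hτ', hlτ', -⟩ := exists_isPrefix_of_le c'.2 (fun _ => 0) (n := L) (by omega)
  obtain ⟨τ'', hτ'', hlτ'', -⟩ := exists_isPrefix_of_le c''.2 (fun _ => 0) (n := L) (by omega)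
  -- Three colors are essential here: two values must be avoided at once.
  have third : ∀ a b : Fin 3, ∃ z, z ≠ a ∧ z ≠ b := by decide
  choose z hz₁ hz₂ using third
  obtain ⟨τ, hτ, hlτ, hτv⟩ := exists_isPrefix_of_le d.2
    (fun i => z (τ'[i]?.getD 0) (τ''[i]?.getD 0)) (n := L) (by simp only at hlen; omega)
  obtain ⟨⟨ν, ρ⟩, ⟨hν, hρ⟩, hk, hF⟩ :=
    (hFd.mono_right (μ := d.1) hτ).exists_le_length hT k
  simp only at hν hρ hk hlen
  have hlρ := hρ.length_le
  have other : ∀ a : Fin 3, ∃ z, z ≠ a := by decide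
  choose y hy using other
  have key : ∀ (b : Pre) (α : List (Fin 3)), c.Le b → Full T b → b.2 <+: α → α.length = L →
      (∀ i, d.2.length ≤ i → i < L → τ[i]? ≠ α[i]?) →
      ∃ e, b.Le e ∧ CrossPair T N (e, (ν, ρ)) := by
    intro b α hcb hFb hα hlα hv
    obtain ⟨β, hβ, hlβ, hβv⟩ := exists_isPrefix_of_le α (fun i => y (ρ[i]?.getD 0))
      (n := ρ.length) (by omega)
    refine ⟨(b.1, β), ⟨List.prefix_rfl, hα.trans hβ⟩, hFb.mono_right (hα.trans hβ), hF, hlβ, ?_⟩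
    intro w hw x hx hx'
    simp only at hx hx'
    have hwρ : w < ρ.length := (List.getElem?_eq_some_iff.1 hx').1
    rcases lt_or_ge w L with hwL | hwL
    · have hα' : α[w]? = some x := by
        rw [← hx]
        obtain ⟨t, rfl⟩ := hβ
        rw [List.getElem?_append_left (by omega)]
      have hτ' : τ[w]? = some x := by
        rw [← hx']
        obtain ⟨t, rfl⟩ := hρ
        rw [List.getElem?_append_left (by omega)]
      rcases lt_or_ge w d.2.length with hwd | hwd
      · have hcα := hcb.2.trans hα
        refine hdisj w hw x ?_ ?_
        · rw [← hα']
          obtain ⟨t, rfl⟩ := hcα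
          rw [List.getElem?_append_left (by omega)]
        · rw [← hτ']
          obtain ⟨t, rfl⟩ := hτ
          rw [List.getElem?_append_left (by omega)]
      · exact hv w hwd hwL (by rw [hτ', hα'])
    · rw [hβv w (by omega) hwρ, hx'] at hx
      exact hy _ (Option.some.inj hx)
  obtain ⟨e', he', hp'⟩ := key c' τ' hc' hF' hτ' hlτ' fun i hi hiL => by
    rw [hτv i hi hiL]
    exact fun h => hz₁ _ _ (congrArg (Option.getD · 0) h)
  obtain ⟨e'', he'', hp''⟩ := key c'' τ'' hc'' hF'' hτ'' hlτ'' fun i hi hiL => by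
    rw [hτv i hi hiL]
    exact fun h => hz₂ _ _ (congrArg (Option.getD · 0) h)
  exact ⟨e', e'', (ν, ρ), he', he'', ⟨hν, hτ.trans hρ⟩, hp', hp'', hk, by simp only; omega⟩

theorem CrossPair.exists_le_length (hT : PrefixClosed T) (h : CrossPair T N q) (k : ℕ) :
    ∃ q' : Pre × Pre, q.1.Le q'.1 ∧ q.2.Le q'.2 ∧ CrossPair T N q' ∧ k ≤ q'.1.1.length ∧
      k ≤ q'.2.1.length ∧ k ≤ q'.1.2.length := by
  obtain ⟨d, hd, hk, hF⟩ := h.left.exists_le_length hT k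
  obtain ⟨e', -, e, he', -, he, hp, -, hk₁, hk₂⟩ := CrossPair.exists_common (c := q.1) (d := q.2)
    hT h hd hF hd hF k
  exact ⟨(e', e), hd.trans he', he, hp, hk.trans he'.1.length_le, hk₁,
    by simpa only [hp.length_eq] using hk₂⟩

/-- Above `c`, the values of the instances on `S` are determined from some place on. -/
def Decides (T : List Bool → List (Fin 3) → Prop) (S : Set ℕ) (c : Pre) : Prop :=
  ∃ m, ∀ d d' : Pre, c.Le d → Full T d → c.Le d' → Full T d' →
    ∀ x, m ≤ x → x ∈ S → ∀ b b', d.1[x]? = some b → d'.1[x]? = some b' → b = b'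

theorem Decides.mono {S : Set ℕ} (h : Decides T S c) (hd : c.Le d) : Decides T S d := by
  obtain ⟨m, h⟩ := h
  exact ⟨m, fun e e' he hF he' hF' => h e e' (hd.trans he) hF (hd.trans he') hF'⟩

/-- Cross two left extensions with a common right one: its bit at `x` differs from both left bits,
which therefore coincide. -/
theorem decides_of_forall_not_agree (hT : PrefixClosed T) {S : Set ℕ} (h : CrossPair T N q)
    (hn : ∀ q' : Pre × Pre, q.1.Le q'.1 → q.2.Le q'.2 → CrossPair T N q' → ¬ Agree S k q') :
    Decides T S q.1 := by
  refine ⟨k, fun c' c'' hc' hF' hc'' hF'' x hx hxS b b' hb hb' => ?_⟩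
  obtain ⟨e', e'', e, he', he'', he, hp', hp'', hl, -⟩ := CrossPair.exists_common (c := q.1)
    (d := q.2) hT h hc' hF' hc'' hF'' (x + 1)
  obtain ⟨v, hv⟩ : ∃ v, e.1[x]? = some v := ⟨_, List.getElem?_eq_getElem hl⟩
  have h₁ : v ≠ b := fun hvb => hn _ (hc'.trans he') he hp'
    ⟨x, hx, hxS, b, getElem?_of_isPrefix he'.1 hb, hvb ▸ hv⟩
  have h₂ : v ≠ b' := fun hvb => hn _ (hc''.trans he'') he hp''
    ⟨x, hx, hxS, b', getElem?_of_isPrefix he''.1 hb', hvb ▸ hv⟩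
  revert h₁ h₂
  cases v <;> cases b <;> cases b' <;> simp

/-- Both halves extend `c`, so once long enough they carry the same decided bit at any large element
of `S`. -/
theorem Decides.exists_agree (hT : PrefixClosed T) {S : Set ℕ} (hS : S.Infinite)
    (hc : Decides T S c) (h₁ : c.Le q.1) (h₂ : c.Le q.2) (h : CrossPair T N q) (k : ℕ) :
    ∃ q' : Pre × Pre, q.1.Le q'.1 ∧ q.2.Le q'.2 ∧ CrossPair T N q' ∧ Agree S k q' := by
  obtain ⟨m, hm⟩ := hc
  obtain ⟨x, hxS, hx⟩ := hS.exists_gt (max m k)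
  obtain ⟨q', hq₁, hq₂, hp, hl₁, hl₂, -⟩ := h.exists_le_length hT (x + 1)
  obtain ⟨v, hv⟩ : ∃ v, q'.1.1[x]? = some v := ⟨_, List.getElem?_eq_getElem hl₁⟩
  obtain ⟨v', hv'⟩ : ∃ v, q'.2.1[x]? = some v := ⟨_, List.getElem?_eq_getElem hl₂⟩
  have : v = v' := hm _ _ (h₁.trans hq₁) hp.left (h₂.trans hq₂) hp.right x
    ((le_max_left _ _).trans hx.le) hxS v v' hv hv'
  exact ⟨q', hq₁, hq₂, hp, x, (le_max_right _ _).trans hx.le, hxS, v, hv, this ▸ hv'⟩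

/-- Some condition has above it no obstacle to making the two instances agree often. -/
theorem exists_full_forall_agree (hT : PrefixClosed T) (hF : Full T ([], [])) {r : ℕ}
    {S : Fin r → Set ℕ} (hS : ∀ s, (S s).Infinite) :
    ∃ c, Full T c ∧ ∀ q : Pre × Pre, c.Le q.1 → c.Le q.2 → CrossPair T c.2.length q → ∀ s k,
      ∃ q' : Pre × Pre, q.1.Le q'.1 ∧ q.2.Le q'.2 ∧ CrossPair T c.2.length q' ∧
        Agree (S s) k q' := by
  classical
  by_contra! hn
  -- Each failure yields an extension deciding one more `S s`: the obstructed set was undecided,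
  -- since a decided one always admits agreement. Only `r` sets are available. `Decides` does not
  -- mention `N`, so the bound may change with `c`.
  have key : ∀ n, ∃ c, Full T c ∧ n ≤ (Finset.univ.filter fun s => Decides T (S s) c).card := by
    intro n
    induction n with
    | zero => exact ⟨_, hF, Nat.zero_le _⟩
    | succ n ih =>
      obtain ⟨c, hc, hcard⟩ := ih
      obtain ⟨q, hq₁, hq₂, hp, s, k, hq⟩ := hn c hc
      refine ⟨q.1, hp.left, hcard.trans_lt (Finset.card_lt_card ?_)⟩
      refine Finset.ssubset_iff_of_subset ?_ |>.2 ⟨s, ?_, ?_⟩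
      · intro t ht
        simp only [Finset.mem_filter, Finset.mem_univ, true_and] at ht ⊢
        exact ht.mono hq₁
      · simpa using decides_of_forall_not_agree hT hp hq
      · simp only [Finset.mem_filter, Finset.mem_univ, true_and]
        intro hd
        obtain ⟨q', h₁, h₂, h₃, h₄⟩ := hd.exists_agree hT (hS s) hq₁ hq₂ hp k
        exact hq q' h₁ h₂ h₃ h₄
  obtain ⟨c, -, hc⟩ := key (r + 1)
  have := Finset.card_le_univ (Finset.univ.filter fun s => Decides T (S s) c)
  simp at this
  omega

end SocRed

/-! ### The cross-constraint basis theorem. -/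

namespace SocRed

variable {T : List Bool → List (Fin 3) → Prop}

theorem arith_full (hT : Arith fun t : Pre => T t.1 t.2) : Arith (Full T) :=
  .all <| .imp .isPrefix <| .imp .le <| .ex <| .and .isPrefix <| .and .eq <| .comp₂ (p := T) hT

theorem arith_crossPair (hT : Arith fun t : Pre => T t.1 t.2) (N : ℕ) :
    Arith (CrossPair T N) := by
  refine Arith.congr (p := fun q : Pre × Pre => Full T q.1 ∧ Full T q.2 ∧
    q.1.2.length = q.2.2.length ∧ ∀ w, N ≤ w → ∀ c, q.1.2[w]? = some c → ¬ q.2.2[w]? = some c)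
    ?_ fun q => ⟨fun h => ⟨h.1, h.2, h.3, h.4⟩, fun h => ⟨h.1, h.2.1, h.2.2.1, h.2.2.2⟩⟩
  exact .and ((arith_full hT).comp primrec_auto) <| .and ((arith_full hT).comp primrec_auto) <|
    .and .eq <| .all <| .imp .le <| .all <| .imp .eq <| .not .eq

theorem arith_agree {S : Set ℕ} (hS : Arith (· ∈ S)) :
    Arith fun t : ℕ × Pre × Pre => Agree S t.1 t.2 :=
  .ex <| .and .le <| .and (.comp hS primrec_auto) <| .ex <| .and .eq .eq

/-- A sequence of growing lists has a limit. -/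
theorem exists_limit {α : Type*} [Inhabited α] {l : ℕ → List α} (hl : ∀ k, l k <+: l (k + 1))
    (hk : ∀ k, k ≤ (l k).length) : ∃ X : ℕ → α,
      (∀ x, (l (x + 1))[x]? = some (X x)) ∧ (∀ k x a, (l k)[x]? = some a → X x = a) ∧
        ∀ k, (l k).take k = (List.range k).map X := by
  have hmono : ∀ k m, k ≤ m → l k <+: l m := fun k m h => by
    induction m, h using Nat.le_induction with
    | base => exact List.prefix_rfl
    | succ m _ ih => exact ih.trans (hl m)
  have hX : ∀ x, (l (x + 1))[x]? = some ((l (x + 1))[x]?.getD default) := fun x => by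
    rw [List.getElem?_eq_getElem (hk (x + 1))]; rfl
  have hX' : ∀ k x a, (l k)[x]? = some a → (l (x + 1))[x]?.getD default = a := by
    intro k x a h
    have h₁ := getElem?_of_isPrefix (hmono k (max k (x + 1)) (le_max_left _ _)) h
    have h₂ := getElem?_of_isPrefix (hmono (x + 1) (max k (x + 1)) (le_max_right _ _)) (hX x)
    exact Option.some.inj (h₂.symm.trans h₁)
  refine ⟨fun x => (l (x + 1))[x]?.getD default, hX, hX', fun k => ?_⟩
  refine List.ext_getElem? fun i => ?_
  rcases lt_or_ge i k with h | h
  · obtain ⟨a, hi⟩ : ∃ a, (l k)[i]? = some a := ⟨_, List.getElem?_eq_getElem (h.trans_le (hk k))⟩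
    rw [List.getElem?_take_of_lt h, hi, List.getElem?_map, List.getElem?_range h, Option.map_some,
      hX' _ _ _ hi]
  · rw [List.getElem?_eq_none (by simp [h]), List.getElem?_eq_none (by simpa using h)]

/-- **Cross-constraint basis theorem.** An arithmetic class which contains an instance for every
`3`-coloring has two members with arithmetic instances whose colorings are eventually different and
whose instances agree infinitely often on each of the given sets. -/
theorem exists_cross (hT : PrefixClosed T) (hTa : Arith fun t : Pre => T t.1 t.2)
    (hF : Full T ([], [])) {r : ℕ} {S : Fin r → Set ℕ} (hSa : ∀ s, Arith (· ∈ S s))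
    (hS : ∀ s, (S s).Infinite) :
    ∃ (X₀ X₁ : ℕ → Bool) (Y₀ Y₁ : ℕ → Fin 3) (N : ℕ),
      (Arith fun x => X₀ x = true) ∧ (Arith fun x => X₁ x = true) ∧
      (∀ k, T ((List.range k).map X₀) ((List.range k).map Y₀)) ∧
      (∀ k, T ((List.range k).map X₁) ((List.range k).map Y₁)) ∧
      (∀ w, N ≤ w → Y₀ w ≠ Y₁ w) ∧ ∀ s, {x | x ∈ S s ∧ X₀ x = X₁ x}.Infinite := by
  classical
  obtain ⟨c, hc, hagree⟩ := exists_full_forall_agree hT hF hS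
  set N := c.2.length with hN
  have hfin : ∀ (A : Finset (Fin r)) k (q : Pre × Pre), c.Le q.1 → c.Le q.2 → CrossPair T N q →
      ∃ q' : Pre × Pre, q.1.Le q'.1 ∧ q.2.Le q'.2 ∧ CrossPair T N q' ∧
        ∀ s ∈ A, Agree (S s) k q' := by
    intro A k
    induction A using Finset.induction_on with
    | empty => exact fun q _ _ hq => ⟨q, .refl _, .refl _, hq, by simp⟩
    | insert s A _ ih =>
      intro q h₁ h₂ hq
      obtain ⟨q', h₁', h₂', hq', hA⟩ := ih q h₁ h₂ hq
      obtain ⟨q'', h₁'', h₂'', hq'', hs⟩ := hagree q' (h₁.trans h₁') (h₂.trans h₂') hq' s k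
      refine ⟨q'', h₁'.trans h₁'', h₂'.trans h₂'', hq'', ?_⟩
      intro t ht
      rcases Finset.mem_insert.1 ht with rfl | ht
      · exact hs
      · exact (hA t ht).mono h₁'' h₂''
  obtain ⟨s, -, hs, hstep, hsa⟩ := Arith.exists_seq
    (Q := fun k (q q' : Pre × Pre) => (q.1.1 <+: q'.1.1 ∧ q.1.2 <+: q'.1.2) ∧
      (q.2.1 <+: q'.2.1 ∧ q.2.2 <+: q'.2.2) ∧ CrossPair T N q' ∧
      (k + 1 ≤ q'.1.1.length ∧ k + 1 ≤ q'.2.1.length ∧ k + 1 ≤ q'.1.2.length) ∧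
      ∀ i, Agree (S i) k q')
    (.and (.and .isPrefix .isPrefix) <| .and (.and .isPrefix .isPrefix) <|
      .and ((arith_crossPair hTa N).comp (f := fun t : ℕ × (Pre × Pre) × Pre × Pre => t.2.2)
        primrec_auto) <|
      .and (.and .le <| .and .le .le) <| .forall_finite fun i =>
        .comp₂ (p := fun k q => Agree (S i) k q) (arith_agree (hSa i)))
    (S := fun q => c.Le q.1 ∧ c.Le q.2 ∧ CrossPair T N q) (a₀ := (c, c))
    -- The pair `(c, c)` is a legitimate start because disjointness is only required from `N`, the
    -- length of its coloring.
    ⟨.refl c, .refl c, hc, hc, rfl, fun w hw x hx => by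
      rw [List.getElem?_eq_none hw] at hx
      cases hx⟩
    (fun k q ⟨h₁, h₂, hq⟩ => by
      obtain ⟨q', h₁', h₂', hq', hA⟩ := hfin Finset.univ k q h₁ h₂ hq
      obtain ⟨q'', h₁'', h₂'', hq'', hl⟩ := hq'.exists_le_length hT (k + 1)
      exact ⟨q'', h₁'.trans h₁'', h₂'.trans h₂'', hq'', hl,
        fun s => (hA s (Finset.mem_univ s)).mono h₁'' h₂''⟩)
    (fun k q q' ⟨h₁, h₂, _⟩ ⟨h₁', h₂', hq', _⟩ => ⟨h₁.trans h₁', h₂.trans h₂', hq'⟩)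
  have hlen : ∀ k, k ≤ (s k).1.1.length ∧ k ≤ (s k).2.1.length ∧ k ≤ (s k).1.2.length := by
    rintro (_ | k)
    · simp
    · exact (hstep k).2.2.2.1
  have hlen' : ∀ k, k ≤ (s k).2.2.length := fun k => (hs k).2.2.length_eq ▸ (hlen k).2.2
  obtain ⟨X₀, hX₀, hX₀', hX₀t⟩ := exists_limit (fun k => (hstep k).1.1) fun k => (hlen k).1
  obtain ⟨X₁, hX₁, hX₁', hX₁t⟩ := exists_limit (fun k => (hstep k).2.1.1) fun k => (hlen k).2.1
  obtain ⟨Y₀, hY₀, -, hY₀t⟩ := exists_limit (fun k => (hstep k).1.2) fun k => (hlen k).2.2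
  obtain ⟨Y₁, hY₁, -, hY₁t⟩ := exists_limit (fun k => (hstep k).2.1.2) hlen'
  refine ⟨X₀, X₁, Y₀, Y₁, N, ?_, ?_, fun k => ?_, fun k => ?_, fun w hw h => ?_, fun i => ?_⟩
  · refine Arith.congr (p := fun x => ∃ q : Pre × Pre, q = s (x + 1) ∧ q.1.1[x]? = some true)
      (.ex <| .and (.comp₂ (p := fun k q => q = s k) hsa) .eq) fun x => by simp [hX₀]
  · refine Arith.congr (p := fun x => ∃ q : Pre × Pre, q = s (x + 1) ∧ q.2.1[x]? = some true)
      (.ex <| .and (.comp₂ (p := fun k q => q = s k) hsa) .eq) fun x => by simp [hX₁]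
  · rw [← hX₀t, ← hY₀t]
    exact (hs k).2.2.left.take hT (hlen k).1 (hlen k).2.2
  · rw [← hX₁t, ← hY₁t]
    exact (hs k).2.2.right.take hT (hlen k).2.1 (hlen' k)
  · exact (hs (w + 1)).2.2.disj w hw _ (hY₀ w) (h ▸ hY₁ w)
  · refine Set.infinite_of_forall_exists_gt fun k => ?_
    obtain ⟨x, hk, hx, b, hb, hb'⟩ := (hstep (k + 1)).2.2.2.2 i
    exact ⟨x, ⟨hx, (hX₀' _ _ _ hb).trans (hX₁' _ _ _ hb').symm⟩, hk⟩

end SocRed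

/-! ### Iterated search in an oracle. -/

namespace SocRed

variable {α β : Type*} [Primcodable α] [Primcodable β]

theorem exists_primrec_encode {f : α → β} (hf : Primrec f) :
    ∃ F : ℕ → ℕ, Primrec F ∧ ∀ a, F (Encodable.encode a) = Encodable.encode (f a) :=
  ⟨_, Primrec.option_getD.comp (Primrec.option_map Primrec.decode
      ((Primrec.encode.comp hf).comp Primrec.snd).to₂) (Primrec.const 0), fun a => by simp⟩

/-- Iterating a step which depends on the least `v` whose query `q` is answered by the truth value
of `v ≠ 0` is computable in the oracle. -/
theorem recursiveIn_iterate_search {W : Set ℕ} {q : ℕ × α × ℕ → ℕ} (hq : Primrec q)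
    {step : ℕ × α × ℕ → α} (hstep : Primrec step) {V : ℕ → α → ℕ} {s : ℕ → α}
    (hV : ∀ e a, q (e, a, V e a) ∈ W ↔ V e a ≠ 0)
    (hV' : ∀ e a v, v < V e a → ¬ (q (e, a, v) ∈ W ↔ v ≠ 0))
    (hs : ∀ e, s (e + 1) = step (e, s e, V e (s e))) :
    Nat.RecursiveIn {fun n => Part.some (chi W n)} fun n => Part.some (Encodable.encode (s n)) := by
  obtain ⟨Q, hQ, hQe⟩ := exists_primrec_encode (f := fun t : (ℕ × α) × ℕ => q (t.1.1, t.1.2, t.2))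
    (hq.comp primrec_auto)
  obtain ⟨St, hSt, hSte⟩ := exists_primrec_encode
    (f := fun t : (ℕ × α) × ℕ => step (t.1.1, t.1.2, t.2)) (hstep.comp primrec_auto)
  set O : Set (ℕ →. ℕ) := {fun n => Part.some (chi W n)} with hO
  have hW : Nat.RecursiveIn O fun n => Part.some (chi W n) := .oracle _ rfl
  -- `1 - (1 - v)` is the truth value of `v ≠ 0`; the sum of the two truncated differences vanishes
  -- exactly when it equals the oracle's answer.
  have htest : Nat.RecursiveIn O fun n => Part.some
      ((chi W (Q n) - (1 - (1 - n.unpair.2))) + ((1 - (1 - n.unpair.2)) - chi W (Q n))) := by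
    have h₁ := recursiveIn_natPair (recursiveIn_comp_primrec hW hQ)
      (Primrec.nat_iff.1 (Primrec.id (α := ℕ))).recursiveIn
    exact (recursiveIn_primrec_comp (f := fun n =>
      (n.unpair.1 - (1 - (1 - n.unpair.2.unpair.2))) +
        ((1 - (1 - n.unpair.2.unpair.2)) - n.unpair.1)) primrec_auto h₁).of_eq fun n => by
          simp
  have hfind := htest.rfind
  have hval : ∀ e a, V e a ∈ Nat.rfind fun v =>
      (fun m => decide (m = 0)) <$> (Part.some
        ((chi W (Q (Nat.pair (Nat.pair e (Encodable.encode a)) v)) - (1 - (1 - v))) +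
          ((1 - (1 - v)) - chi W (Q (Nat.pair (Nat.pair e (Encodable.encode a)) v)))) :
            Part ℕ) := by
    intro e a
    have hQ' : ∀ v, Q (Nat.pair (Nat.pair e (Encodable.encode a)) v) = q (e, a, v) := fun v =>
      hQe ((e, a), v)
    refine Nat.mem_rfind.2 ⟨?_, fun {m} hm => ?_⟩
    · simp only [Part.map_eq_map, Part.map_some, Part.mem_some_iff, hQ']
      by_cases h : V e a = 0
      · rw [chi_of_notMem (fun hn => (hV e a).1 hn h), h]; simp
      · rw [chi_of_mem ((hV e a).2 h)]
        symm
        simp only [decide_eq_true_eq]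
        omega
    · have := hV' e a m hm
      simp only [Part.map_eq_map, Part.map_some, Part.mem_some_iff, hQ']
      by_cases h : m = 0
      · rw [chi_of_mem (by tauto), h]; simp
      · rw [chi_of_notMem (by tauto)]
        symm
        simp only [decide_eq_false_iff_not]
        omega
  have hz : Nat.RecursiveIn O (fun n => (Part.some n.unpair.2 : Part ℕ)) := .right
  have hid := (Primrec.nat_iff.1 (Primrec.id (α := ℕ))).recursiveIn (O := O)
  have hstep' := (Primrec.nat_iff.1 hSt).recursiveIn (O := O) |>.comp ((hid.pair hfind).comp hz)
  have hrec := (Primrec.nat_iff.1 (Primrec.const (Encodable.encode (s 0)))).recursiveIn (O := O)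
    |>.prec hstep'
  have harg : Primrec fun n : ℕ => Nat.pair 0 n := primrec_auto
  refine (hrec.comp (Primrec.nat_iff.1 harg).recursiveIn).of_eq fun n => ?_
  refine (Part.bind_some _ _).trans ?_
  simp only [Nat.unpair_pair]
  induction n with
  | zero => rfl
  | succ n ih =>
    simp only [ih]
    refine (Part.bind_some _ _).trans ?_
    refine (congrArg (fun p : Part ℕ => p.bind _) (Part.bind_some _ _)).trans ?_
    have h := hSte ((n, s n), V n (s n))
    simp only [Encodable.encode_prod_val, Encodable.encode_nat] at h
    refine Part.eq_some_iff.2 (Part.mem_bind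
      (Part.mem_bind (Part.mem_map _ (Part.mem_some _))
        (Part.mem_map _ (a := V n (s n)) (hval n (s n)))) ?_)
    simp only [id]
    rw [hs, ← h]
    exact Part.mem_some _

end SocRed

/-! ### Construction of the hyperimmune coloring. -/

namespace SocRed

/-- The object coded by `v`, if any; the code of `a` is `codeSome a`. -/
def decodeOption (α : Type*) [Primcodable α] (v : ℕ) : Option α :=
  (Encodable.decode v : Option (Option α)).getD none

/-- A positive code of `a`. -/
def codeSome {α : Type*} [Primcodable α] (a : α) : ℕ := Encodable.encode a + 1

theorem primrec_decodeOption (α : Type*) [Primcodable α] : Primrec (decodeOption α) :=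
  Primrec.option_getD.comp Primrec.decode (Primrec.const none)

theorem decodeOption_codeSome {α : Type*} [Primcodable α] (a : α) :
    decodeOption α (codeSome a) = some a := by
  have h : (Encodable.decode (codeSome a) : Option (Option α)) = some (some a) :=
    Encodable.encodek (some a)
  rw [decodeOption, h, Option.getD_some]

theorem exists_eval_codeSome {α : Type*} [Primcodable α] {g : ℕ → ℕ} {F : ℕ → α}
    (hF : ComputableIn {fun n => Part.some (g n)} F) :
    ∃ c : OCode, ∀ n, ∃ k, c.eval g n = Part.some k ∧ codeSome (F n) = k + 1 := by
  obtain ⟨c, hc⟩ := OCode.exists_eval_eq_of_recursiveIn hF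
  exact ⟨c, fun n => ⟨Encodable.encode (F n), by rw [hc]; simp, rfl⟩⟩

/-- The color assigned to `x` by a tuple of disjoint lists. -/
def colorOf (F : Fin 3 → List ℕ) (x : ℕ) : Fin 3 :=
  if ∃ a ∈ F 0, a = x then 0 else if ∃ a ∈ F 1, a = x then 1 else 2

theorem colorOf_eq {F : Fin 3 → List ℕ} (hF : ∀ i j, i ≠ j → List.Disjoint (F i) (F j)) {j : Fin 3}
    {x : ℕ} (hx : x ∈ F j) : colorOf F x = j := by
  have h : ∀ i, i ≠ j → x ∉ F i := fun i hi hxi => hF i j hi hxi hx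
  fin_cases j
  · simp only [Fin.zero_eta] at hx
    simp [colorOf, hx]
  · have h0 := h 0 (by simp)
    simp only [Fin.mk_one] at hx
    simp [colorOf, hx, h0]
  · have h0 := h 0 (by simp)
    have h1 := h 1 (by simp)
    simp [colorOf, h0, h1]

/-- The tuple of lists coded by `v`. -/
def decodeTuple (v : ℕ) : Fin 3 → List ℕ := (decodeOption (Fin 3 → List ℕ) v).getD fun _ => []

/-- Extend the partial coloring `l` so that it agrees with the tuple of lists coded by `v`. -/
def extendBy (l : List (Fin 3)) (v : ℕ) : List (Fin 3) :=
  l ++ (List.range ((decodeTuple v 0 ++ decodeTuple v 1 ++ decodeTuple v 2).foldr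
    (fun a b => a + b) 1)).map fun i => colorOf (decodeTuple v) (l.length + i)

theorem primrec_extendBy : Primrec fun t : List (Fin 3) × ℕ => extendBy t.1 t.2 := by
  have hF : Primrec decodeTuple :=
    Primrec.option_getD.comp (primrec_decodeOption _) (Primrec.const _)
  have happ : ∀ j : Fin 3, Primrec fun F : Fin 3 → List ℕ => F j := fun j =>
    Primrec.fin_app.comp Primrec.id (Primrec.const j)
  -- The form `∃ a ∈ F j, a = x` in `colorOf` is the one `exists_mem_list` handles.
  have hmem : ∀ j : Fin 3, PrimrecPred fun t : (Fin 3 → List ℕ) × ℕ => ∃ a ∈ t.1 j, a = t.2 :=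
    fun j => PrimrecRel.comp (Primrec.eq (α := ℕ)).exists_mem_list ((happ j).comp Primrec.fst)
      Primrec.snd
  have hcol : Primrec fun t : (Fin 3 → List ℕ) × ℕ => colorOf t.1 t.2 :=
    Primrec.ite (hmem 0) (Primrec.const 0) (Primrec.ite (hmem 1) (Primrec.const 1)
      (Primrec.const 2))
  have hsum : Primrec fun l : List ℕ => l.foldr (fun a b => a + b) 1 :=
    Primrec.list_foldr Primrec.id (Primrec.const 1) (Primrec.nat_add.comp
      (Primrec.fst.comp Primrec.snd) (Primrec.snd.comp Primrec.snd)).to₂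
  have hF' := fun j => ((happ j).comp hF).comp (Primrec.snd (α := List (Fin 3)) (β := ℕ))
  refine primrec_append Primrec.fst (Primrec.list_map (Primrec.list_range.comp (hsum.comp
    (primrec_append (primrec_append (hF' 0) (hF' 1)) (hF' 2)))) ?_)
  exact (hcol.comp (Primrec.pair (hF.comp (Primrec.snd.comp Primrec.fst))
    (primrec_add (primrec_length (Primrec.fst.comp Primrec.fst)) Primrec.snd))).to₂

theorem isPrefix_extendBy (l : List (Fin 3)) (v : ℕ) : l <+: extendBy l v := List.prefix_append _ _

/-- One plus the sum exceeds every element, so `extendBy` reaches all of the tuple; being positive,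
it makes every step lengthen the string. -/
theorem le_foldr_add_one (l : List ℕ) : (∀ x ∈ l, x < l.foldr (fun a b => a + b) 1) ∧
    0 < l.foldr (fun a b => a + b) 1 := by
  induction l with
  | nil => simp
  | cons a l ih =>
    simp only [List.mem_cons, forall_eq_or_imp, List.foldr_cons]
    exact ⟨⟨by omega, fun x hx => (ih.1 x hx).trans_le (by omega)⟩, by omega⟩

theorem length_lt_extendBy (l : List (Fin 3)) (v : ℕ) : l.length < (extendBy l v).length := by
  simp only [extendBy, List.length_append, List.length_map, List.length_range]
  have := (le_foldr_add_one (decodeTuple v 0 ++ decodeTuple v 1 ++ decodeTuple v 2)).2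
  omega

theorem extendBy_encode {F : Fin 3 → List ℕ} (hF : ∀ i j, i ≠ j → List.Disjoint (F i) (F j))
    {l : List (Fin 3)} {j : Fin 3} {x : ℕ} (hx : x ∈ F j) (hl : l.length ≤ x) :
    (extendBy l (codeSome F))[x]? = some j := by
  simp only [extendBy, decodeTuple, decodeOption_codeSome, Option.getD_some]
  have hlt := (le_foldr_add_one (F 0 ++ F 1 ++ F 2)).1 x (by
    simp only [List.mem_append]
    fin_cases j
    · exact .inl (.inl hx)
    · exact .inl (.inr hx)
    · exact .inr hx)
  rw [List.getElem?_append_right hl, List.getElem?_map, List.getElem?_range (by omega),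
    Option.map_some, Nat.add_sub_cancel' hl, colorOf_eq hF hx]

/-- The index of a program which, for `i` the index of a program `c`, halts exactly if `c` halts
on `n` with a value `y` and moreover `v = 0` or `v = y + 1`. -/
def queryIndex (E : OCode) (i n v : ℕ) : ℕ :=
  4 * Nat.pair E.index (4 * Nat.pair (4 * Nat.pair i (OCode.const n).index + 6)
    (OCode.const v).index + 5) + 6

/-- Search for a zero of `v * |v - (y + 1)|`, which does not depend on the search variable: it stops
at once or never. -/
theorem exists_test : ∃ E : OCode, ∀ (g : ℕ → ℕ) (y v : ℕ),
    (E.eval g (Nat.pair y v)).Dom ↔ v = 0 ∨ v = y + 1 := by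
  have h : Primrec fun n : ℕ => n.unpair.1.unpair.2 *
      ((n.unpair.1.unpair.2 - (n.unpair.1.unpair.1 + 1)) +
        ((n.unpair.1.unpair.1 + 1) - n.unpair.1.unpair.2)) := primrec_auto
  obtain ⟨D, hD⟩ := OCode.exists_eval_eq_of_partrec (Nat.Partrec.of_primrec (Primrec.nat_iff.1 h))
  refine ⟨.rfind D, fun g y v => ?_⟩
  have hE : ∀ m k, k ∈ D.eval g (Nat.pair (Nat.pair y v) m) ↔
      k = v * ((v - (y + 1)) + ((y + 1) - v)) := fun m k => by rw [hD]; simp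
  rw [Part.dom_iff_mem]
  simp only [OCode.mem_eval_rfind, hE]
  constructor
  · rintro ⟨m, hm, -⟩
    rcases Nat.mul_eq_zero.1 hm.symm with h | h <;> omega
  · intro h
    refine ⟨0, ?_, by simp⟩
    rcases h with rfl | rfl <;> simp

theorem queryIndex_mem_jump {E : OCode} (hE : ∀ (g : ℕ → ℕ) (y v : ℕ),
    (E.eval g (Nat.pair y v)).Dom ↔ v = 0 ∨ v = y + 1) {A : Set ℕ} {c : OCode} {n v : ℕ} :
    queryIndex E c.index n v ∈ jump A ↔ ∃ y ∈ c.eval (chi A) n, v = 0 ∨ v = y + 1 := by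
  change (OCode.comp E (.pair (.comp c (.const n)) (.const v))).index ∈ jump A ↔ _
  rw [OCode.index_mem_jump, Part.dom_iff_mem]
  simp only [OCode.mem_eval_comp, OCode.mem_eval_pair, OCode.eval_const, Part.mem_some_iff,
    exists_eq_left, ← hE (chi A), Part.dom_iff_mem]
  constructor
  · rintro ⟨z, _, ⟨y, hy, rfl⟩, hz⟩
    exact ⟨y, hy, z, hz⟩
  · rintro ⟨y, hy, z, hz⟩
    exact ⟨z, _, ⟨y, hy, rfl⟩, hz⟩

/-- Stages run over all numbers, including those that index no program; there every query must be
answered negatively. -/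
theorem exists_index_of_queryIndex_mem_jump {E : OCode} {A : Set ℕ} {i n v : ℕ}
    (h : queryIndex E i n v ∈ jump A) : ∃ c : OCode, c.index = i := by
  obtain ⟨d, hd, -⟩ := h
  cases d with
  | comp a b =>
    have h₁ : Nat.pair a.index b.index = Nat.pair E.index
        (4 * Nat.pair (4 * Nat.pair i (OCode.const n).index + 6) (OCode.const v).index + 5) := by
      simp only [OCode.index, queryIndex] at hd; omega
    have h₂ := (Nat.pair_eq_pair.1 h₁).2
    cases b with
    | pair a b =>
      have h₃ : Nat.pair a.index b.index =
          Nat.pair (4 * Nat.pair i (OCode.const n).index + 6) (OCode.const v).index := by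
        simp only [OCode.index] at h₂; omega
      have h₄ := (Nat.pair_eq_pair.1 h₃).1
      cases a with
      | comp a b =>
        have h₅ : Nat.pair a.index b.index = Nat.pair i (OCode.const n).index := by
          simp only [OCode.index] at h₄; omega
        exact ⟨a, (Nat.pair_eq_pair.1 h₅).1⟩
      | _ => simp only [OCode.index] at h₄; omega
    | _ => simp only [OCode.index] at h₂; omega
  | _ => simp only [OCode.index, queryIndex] at hd; omega

/-- There is an `∅⁽ω⁾`-computable coloring hyperimmune relative to every arithmetic set. -/
theorem exists_hyperimmuneRel_arithmetic : ∃ C : ℕ → Fin 3,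
    TuringReducible (fun n => Part.some (C n : ℕ)) (fun n => Part.some (chi emptyOmegaJump n)) ∧
      ∀ D : Set ℕ, IsArithmetic D → HyperimmuneRel C D := by
  classical
  obtain ⟨E, hE⟩ := exists_test
  let q : ℕ × List (Fin 3) × ℕ → ℕ := fun t =>
    Nat.pair (t.1.unpair.1 + 1) (queryIndex E t.1.unpair.2 t.2.1.length t.2.2)
  have hq : Primrec q := by
    simp only [q, queryIndex]
    exact primrec_auto
  have hqW : ∀ e l v, q (e, l, v) ∈ emptyOmegaJump ↔
      queryIndex E e.unpair.2 l.length v ∈ jump (emptyJump e.unpair.1) := fun e l v => by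
    simp [q, emptyOmegaJump, emptyJump_succ]
  -- Divergence satisfies the equivalence at `v = 0`. On convergence to `y`, the query holds exactly
  -- for `0` and `y + 1`, so the least solution is `y + 1`.
  have hex : ∀ e l, ∃ v, q (e, l, v) ∈ emptyOmegaJump ↔ v ≠ 0 := by
    intro e l
    by_cases h : q (e, l, 0) ∈ emptyOmegaJump
    · rw [hqW] at h
      obtain ⟨c, hc⟩ := exists_index_of_queryIndex_mem_jump h
      rw [← hc, queryIndex_mem_jump hE] at h
      obtain ⟨y, hy, -⟩ := h
      refine ⟨y + 1, ?_⟩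
      rw [hqW, ← hc, queryIndex_mem_jump hE]
      exact iff_of_true ⟨y, hy, .inr rfl⟩ (Nat.succ_ne_zero y)
    · exact ⟨0, by simpa using h⟩
  let V : ℕ → List (Fin 3) → ℕ := fun e l => Nat.find (hex e l)
  let s : ℕ → List (Fin 3) := fun n => Nat.rec [] (fun e l => extendBy l (V e l)) n
  have hrec := recursiveIn_iterate_search hq (step := fun t => extendBy t.2.1 t.2.2)
    (primrec_extendBy.comp Primrec.snd) (V := V) (s := s)
    (fun e l => Nat.find_spec (hex e l)) (fun e l v hv => Nat.find_min (hex e l) hv) fun e => rfl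
  have hslen : ∀ k, k ≤ (s k).length := fun k => by
    induction k with
    | zero => exact Nat.zero_le _
    | succ k ih => exact ih.trans_lt (length_lt_extendBy _ _)
  obtain ⟨C, hC, hC', -⟩ := exists_limit (fun k => isPrefix_extendBy (s k) (V k (s k))) hslen
  refine ⟨C, RecursiveIn.iff_nat.2 ?_, ?_⟩
  · obtain ⟨G, hG, hGe⟩ := exists_primrec_encode (f := fun t : ℕ × List (Fin 3) =>
      ((t.2[t.1]?.getD 0 : Fin 3) : ℕ)) (Primrec.fin_val.comp (Primrec.option_getD.comp
        primrec_auto (Primrec.const 0)))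
    have h₁ := recursiveIn_comp_primrec hrec (g := fun n => n + 1) primrec_auto
    refine (recursiveIn_primrec_comp hG (recursiveIn_natPair
      (Primrec.nat_iff.1 (Primrec.id (α := ℕ))).recursiveIn h₁)).of_eq fun n => ?_
    have h := hGe (n, s (n + 1))
    simp only [Encodable.encode_prod_val, Encodable.encode_nat, hC, Option.getD_some] at h
    rw [id, h]
  · rintro D ⟨m, hm⟩ F hF hdisj hlt
    obtain ⟨c, hc⟩ := exists_eval_codeSome (g := chi (emptyJump m)) (F := F)
      (RecursiveIn.subst hF fun g hg => by rw [Set.mem_singleton_iff.1 hg]; exact hm)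
    set e := Nat.pair m c.index with he
    -- The array is met at the current length: the entries of `F n` exceed `n`, so none of them is
    -- colored yet.
    set n := (s e).length with hn
    have hV : V e (s e) = codeSome (F n) := by
      obtain ⟨k, hk, hk'⟩ := hc n
      have hspec := Nat.find_spec (hex e (s e))
      have hmem : ∀ v, q (e, s e, v) ∈ emptyOmegaJump ↔
          v = 0 ∨ v = k + 1 := fun v => by
        rw [hqW, he, Nat.unpair_pair, queryIndex_mem_jump hE, ← he, ← hn, hk]
        simp
      rw [hmem] at hspec
      change V e (s e) = 0 ∨ V e (s e) = _ ↔ V e (s e) ≠ 0 at hspec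
      rw [hk']
      by_cases h0 : V e (s e) = 0 <;> tauto
    refine ⟨n, fun j x hx => hC' (e + 1) x j ?_⟩
    change (extendBy (s e) (V e (s e)))[x]? = some j
    rw [hV]
    exact extendBy_encode (hdisj n) hx (hlt n j x hx).le

end SocRed

/-! ### Mathias forcing with arithmetic reservoirs. -/

namespace SocRed

theorem primrec_tuple_apply {α : Type*} [Primcodable α] {f : α → Fin 3 → List ℕ} (hf : Primrec f)
    (j : Fin 3) : Primrec fun a => f a j :=
  Primrec.fin_app.comp hf (Primrec.const j)

/-- Hyperimmunity relative to all arithmetic sets, for arithmetic relations. -/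
theorem exists_agree_of_arith {C : ℕ → Fin 3} (hC : ∀ D, IsArithmetic D → HyperimmuneRel C D)
    {p : ℕ → (Fin 3 → List ℕ) → Prop} (hp : Arith fun t : ℕ × (Fin 3 → List ℕ) => p t.1 t.2)
    (h : ∀ n, ∃ F, p n F) (hdisj : ∀ n F, p n F → ∀ i j, i ≠ j → List.Disjoint (F i) (F j))
    (hlt : ∀ n F, p n F → ∀ j, ∀ x ∈ F j, n < x) :
    ∃ n F, p n F ∧ ∀ j, ∀ x ∈ F j, C x = j := by
  obtain ⟨f, hf, hfa⟩ := Arith.exists_choice hp h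
  obtain ⟨D, hD, hfD⟩ := Arith.exists_computableIn hfa
  obtain ⟨n, hn⟩ := hC D hD f hfD (fun n => hdisj n _ (hf n)) fun n => hlt n _ (hf n)
  exact ⟨n, f n, hf n, hn⟩

/-- Apply hyperimmunity to arrays with a single element of `Z` above `n + m`, placed in the list of
color `j`. -/
theorem infinite_color_of_arith {C : ℕ → Fin 3} (hC : ∀ D, IsArithmetic D → HyperimmuneRel C D)
    {Z : Set ℕ} (hZ : Arith (· ∈ Z)) (hZi : Z.Infinite) (j : Fin 3) :
    {x | x ∈ Z ∧ C x = j}.Infinite := by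
  refine Set.infinite_of_forall_exists_gt fun m => ?_
  obtain ⟨n, F, ⟨x, hx, hxZ, hF, hF'⟩, hCF⟩ := exists_agree_of_arith hC
    (p := fun n F => ∃ x, n + m < x ∧ x ∈ Z ∧ F j = [x] ∧ ∀ i, i ≠ j → F i = [])
    (.ex <| .and .lt <| .and (.comp hZ primrec_auto) <| .and
      (.eq (primrec_tuple_apply (Primrec.snd.comp Primrec.fst) j)
        (Primrec.list_cons.comp Primrec.snd (Primrec.const []))) <|
      .forall_finite fun i => .imp (.const _) <|
        .eq (primrec_tuple_apply (Primrec.snd.comp Primrec.fst) i) (Primrec.const []))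
    (fun n => by
      obtain ⟨x, hxZ, hx⟩ := hZi.exists_gt (n + m)
      exact ⟨fun i => if i = j then [x] else [], x, hx, hxZ, by simp, fun i hi => by simp [hi]⟩)
    (by
      rintro n F ⟨x, -, -, -, hF⟩ i i' hi
      by_cases h : i = j
      · rw [hF i' (fun h' => hi (h.trans h'.symm))]; simp
      · rw [hF i h]; simp)
    (by
      rintro n F ⟨x, hx, -, hF, hF'⟩ i y hy
      by_cases h : i = j
      · rw [h, hF, List.mem_singleton] at hy; omega
      · rw [hF' i h] at hy; simp at hy)
  exact ⟨x, ⟨hxZ, hCF j x (by simp [hF])⟩, by omega⟩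

/-- Every `2`-coloring restricts on some arithmetic set to a coloring which is refined by one that
splits all arithmetic subsets of this set. -/
theorem exists_splitting {C : ℕ → Fin 3} (hC : ∀ D, IsArithmetic D → HyperimmuneRel C D)
    (c : ℕ → Fin 2) : ∃ (R : Set ℕ) (d : ℕ → Bool), Arith (· ∈ R) ∧ R.Infinite ∧
      (∀ Z : Set ℕ, Arith (· ∈ Z) → Z.Infinite → Z ⊆ R → ∀ b, {x | x ∈ Z ∧ d x = b}.Infinite) ∧
      ∀ b, ∃ j, ∀ x ∈ R, d x = b → c x = j := by
  by_cases h : ∃ Z : Set ℕ, Arith (· ∈ Z) ∧ Z.Infinite ∧ ∃ b, {x | x ∈ Z ∧ c x = b}.Finite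
  · obtain ⟨Z, hZ, hZi, b, hb⟩ := h
    obtain ⟨M, hM⟩ := hb.bddAbove
    -- Beyond `M` the coloring `c` is constant, so any `d` refines it; `C` itself supplies a
    -- splitting one.
    refine ⟨{x | x ∈ Z ∧ M < x}, fun x => decide (C x = 0), hZ.and .lt, ?_, ?_, ?_⟩
    · refine Set.infinite_of_forall_exists_gt fun m => ?_
      obtain ⟨x, hx, hx'⟩ := hZi.exists_gt (max m M)
      exact ⟨x, ⟨hx, (le_max_right _ _).trans_lt hx'⟩, (le_max_left _ _).trans_lt hx'⟩
    · rintro W hW hWi - (_ | _)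
      · exact (infinite_color_of_arith hC hW hWi 1).mono fun x hx => ⟨hx.1, by simp [hx.2]⟩
      · exact (infinite_color_of_arith hC hW hWi 0).mono fun x hx => ⟨hx.1, by simp [hx.2]⟩
    · refine fun _ => ⟨1 - b, fun x hx _ => ?_⟩
      have hx' : c x ≠ b := fun h => absurd (hM ⟨hx.1, h⟩) (not_le.2 hx.2)
      have key : ∀ a b : Fin 2, a ≠ b → a = 1 - b := by decide
      exact key _ _ hx'
  · push Not at h
    refine ⟨Set.univ, fun x => decide (c x = 1), .const _, Set.infinite_univ, ?_, ?_⟩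
    · rintro Z hZ hZi - (_ | _)
      · exact (h Z hZ hZi 0).mono fun x hx => ⟨hx.1, by simp [hx.2]⟩
      · exact (h Z hZ hZi 1).mono fun x hx => ⟨hx.1, by simp [hx.2]⟩
    · intro b
      cases b
      · exact ⟨0, fun x _ hx => by simp at hx; omega⟩
      · exact ⟨1, fun x _ hx => by simpa using hx⟩

/-- The numbers coding an element of color `ρ s` in column `s`, for some `s`. -/
def side {r : ℕ} (d : ℕ → Bool) (ρ : Fin r → Bool) : Set ℕ :=
  {p | ∃ s : Fin r, p.unpair.1 = s ∧ d p = ρ s}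

/-- A finite set of codes together with an arithmetic reservoir of codes in `R₀`. -/
structure Cond (r : ℕ) (R₀ : Set ℕ) where
  stem : Finset ℕ
  res : Set ℕ
  stem_subset : ↑stem ⊆ R₀
  res_subset : res ⊆ R₀
  arith : Arith (· ∈ res)
  infinite : ∀ s : Fin r, {p | p ∈ res ∧ p.unpair.1 = s}.Infinite

/-- The Mathias extension order. -/
structure Cond.Le {r : ℕ} {R₀ : Set ℕ} (p q : Cond r R₀) : Prop where
  stem : p.stem ⊆ q.stem
  res : q.res ⊆ p.res
  new : ↑q.stem ⊆ ↑p.stem ∪ p.res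

/-- The condition `q` forces that, on some side, the given functional does not compute an infinite
set of the given color. -/
def Cond.Forces {r : ℕ} {R₀ : Set ℕ} (C : ℕ → Fin 3) (d : ℕ → Bool) (Φ : (Fin r → Bool) → OCode)
    (J : (Fin r → Bool) → Fin 3) (q : Cond r R₀) : Prop :=
  ∃ ρ : Fin r → Bool, ∀ G : Set ℕ, ↑q.stem ⊆ G → G ⊆ ↑q.stem ∪ q.res → ∀ K : Set ℕ, K.Infinite →
    (∀ x ∈ K, C x = J ρ) → ¬ ∀ n, (Φ ρ).eval (chi (G ∩ side d ρ)) n = Part.some (chi K n)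

section

variable {r : ℕ} {R₀ : Set ℕ} {C : ℕ → Fin 3} {d : ℕ → Bool} {Φ : (Fin r → Bool) → OCode}
  {J : (Fin r → Bool) → Fin 3} {q q' : Cond r R₀}

theorem Cond.Le.refl (q : Cond r R₀) : q.Le q :=
  ⟨subset_rfl, subset_rfl, Set.subset_union_left⟩

theorem Cond.Le.trans {p q q' : Cond r R₀} (h : p.Le q) (h' : q.Le q') : p.Le q' :=
  ⟨h.stem.trans h'.stem, h'.res.trans h.res,
    h'.new.trans (Set.union_subset h.new (h.res.trans Set.subset_union_right))⟩

/-- `ν` (a partition of the codes) and `τ` (a coloring) are such that no functional, on a finite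
extension of its stem inside the reservoir which respects `ν`, outputs a number above `n` whose
color is wrong. -/
def Constraint (Φ : (Fin r → Bool) → OCode) (J : (Fin r → Bool) → Fin 3)
    (σ : (Fin r → Bool) → List ℕ) (R : Set ℕ) (n : ℕ) (ν : List Bool) (τ : List (Fin 3)) : Prop :=
  ν.length = τ.length ∧ ∀ (ρ : Fin r → Bool) (E : List ℕ),
    (∀ p, p ∈ E → p ∈ R ∧ ∃ s : Fin r, p.unpair.1 = (s : ℕ) ∧ ν[p]? = some (ρ s)) →
      ∀ w, n < w → 1 ∈ (Φ ρ).eval (chi {p | p ∈ σ ρ ++ E}) w → ∀ j, τ[w]? = some j → j = J ρ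

theorem arith_constraint (σ : (Fin r → Bool) → List ℕ) {R : Set ℕ} (hR : Arith (· ∈ R)) :
    Arith fun t : ℕ × List Bool × List (Fin 3) => Constraint Φ J σ R t.1 t.2.1 t.2.2 :=
  .and .eq <| .forall_finite fun ρ => .all <| .imp (.all <| .imp .mem <|
    .and (.comp hR primrec_auto) <| .exists_finite fun s => .and .eq .eq) <| .all <| .imp .lt <|
    .imp (.comp₃ (p := fun E x y => y ∈ (Φ ρ).eval (chi {p | p ∈ E}) x) (.mem_eval (Φ ρ))) <|
    .all <| .imp .eq .eq

theorem prefixClosed_constraint (σ : (Fin r → Bool) → List ℕ) (R : Set ℕ) (n : ℕ) :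
    PrefixClosed (Constraint Φ J σ R n) := by
  rintro ν τ ν' τ' ⟨-, h⟩ hν hτ hl
  refine ⟨hl, fun ρ E hE w hw h1 j hj => h ρ E (fun p hp => ?_) w hw h1 j
    (getElem?_of_isPrefix hτ hj)⟩
  obtain ⟨hpR, s, hs, hs'⟩ := hE p hp
  exact ⟨hpR, s, hs, getElem?_of_isPrefix hν hs'⟩

theorem arith_res_diff {R : Set ℕ} (hR : Arith (· ∈ R)) (u : ℕ) :
    Arith (· ∈ {p | p ∈ R ∧ u ≤ p}) :=
  hR.and .le

theorem infinite_res_diff {A : Set ℕ} (hA : A.Infinite) (u : ℕ) : {p | p ∈ A ∧ u ≤ p}.Infinite := by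
  refine Set.infinite_of_forall_exists_gt fun m => ?_
  obtain ⟨x, hx, hx'⟩ := hA.exists_gt (max m u)
  exact ⟨x, ⟨hx, (le_max_right _ _).trans hx'.le⟩, (le_max_left _ _).trans_lt hx'⟩

open Classical in
/-- The part of the stem on the given side, as a list. -/
noncomputable def Cond.sideStem (q : Cond r R₀) (d : ℕ → Bool) (ρ : Fin r → Bool) : List ℕ :=
  (q.stem.filter (· ∈ side d ρ)).toList

theorem Cond.mem_sideStem {ρ : Fin r → Bool} {p : ℕ} :
    p ∈ q.sideStem d ρ ↔ p ∈ q.stem ∧ p ∈ side d ρ := by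
  simp [Cond.sideStem]

/-- If no constraint is satisfiable for all colorings, then hyperimmunity yields a computation
with an output of the wrong color. -/
theorem Cond.exists_forces_of_not_full (hC : ∀ D, IsArithmetic D → HyperimmuneRel C D)
    (q : Cond r R₀) (h : ∀ n, ¬ Full (Constraint Φ J (q.sideStem d) q.res n) ([], [])) :
    ∃ q', q.Le q' ∧ q'.Forces C d Φ J := by
  classical
  have hT := arith_constraint (Φ := Φ) (J := J) (q.sideStem d) q.arith
  -- The lists are the color classes of `τ` above `n`. The array is arithmetic because `d` enters
  -- only through the finite stems.
  obtain ⟨n, F, ⟨τ, hτ, hτF⟩, hF⟩ := exists_agree_of_arith hC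
    (p := fun n F => ∃ τ : List (Fin 3),
      (∀ ν : List Bool, ν.length = τ.length → ¬ Constraint Φ J (q.sideStem d) q.res n ν τ) ∧
      ∀ j x, x ∈ F j ↔ n < x ∧ τ[x]? = some j)
    (.ex <| .and (.all <| .imp .eq <| .not <|
      .comp₃ (p := Constraint Φ J (q.sideStem d) q.res) hT) <| .forall_finite fun j => .all <| by
        have h₁ : Arith fun t : ((ℕ × (Fin 3 → List ℕ)) × List (Fin 3)) × ℕ => t.2 ∈ t.1.1.2 j :=
          .mem (primrec_tuple_apply (Primrec.snd.comp (Primrec.fst.comp Primrec.fst)) j)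
        have h₂ : Arith fun t : ((ℕ × (Fin 3 → List ℕ)) × List (Fin 3)) × ℕ =>
          t.1.1.1 < t.2 ∧ t.1.2[t.2]? = some j := .and .lt .eq
        exact ((h₁.imp h₂).and (h₂.imp h₁)).congr fun t => iff_iff_implies_and_implies)
    (fun n => by
      have hn := h n
      simp only [Full, not_forall] at hn
      obtain ⟨τ, -, -, hτ⟩ := hn
      refine ⟨fun j => (List.range τ.length).filter fun x => n < x ∧ τ[x]? = some j, τ,
        fun ν hν hc => hτ ⟨ν, List.nil_prefix, hν, hc⟩, fun j x => ?_⟩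
      simp only [List.mem_filter, List.mem_range, decide_eq_true_eq, and_iff_right_iff_imp]
      exact fun hx => (List.getElem?_eq_some_iff.1 hx.2).1)
    (by
      rintro n F ⟨τ, -, hτ⟩ i j hij x hi hj
      rw [hτ] at hi hj
      exact hij (Option.some.inj (hi.2.symm.trans hj.2)))
    (by
      rintro n F ⟨τ, -, hτ⟩ j x hx
      exact ((hτ j x).1 hx).1)
  -- No partition works for `τ`, in particular not the true one given by `d`, however complex it is.
  have hn := hτ ((List.range τ.length).map d) (by simp)
  simp only [Constraint, List.length_map, List.length_range, true_and, not_forall] at hn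
  obtain ⟨ρ, E, hE, w, hw, h1, j, hj, hjJ⟩ := hn
  have hE' : ∀ p ∈ E, p ∈ q.res ∧ p ∈ side d ρ := fun p hp => by
    obtain ⟨hpR, s, hs, hs'⟩ := hE p hp
    obtain ⟨x, hx, hx'⟩ := by simpa only [List.getElem?_map, Option.map_eq_some_iff] using hs'
    rw [List.getElem?_eq_some_iff] at hx
    obtain ⟨hxl, hx⟩ := hx
    rw [List.getElem_range] at hx
    exact ⟨hpR, s, hs, by rw [← hx', hx]⟩
  -- Discarding the reservoir below the use `u` protects the wrong output from later additions.
  obtain ⟨u, hu⟩ := OCode.exists_use _ h1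
  refine ⟨⟨q.stem ∪ E.toFinset, {p | p ∈ q.res ∧ u ≤ p}, ?_, fun p hp => q.res_subset hp.1,
    arith_res_diff q.arith u, fun s => ?_⟩,
    ⟨Finset.subset_union_left, fun p hp => hp.1, ?_⟩, ρ, fun G hG hG' K _ hKC hK => ?_⟩
  · rw [Finset.coe_union]
    exact Set.union_subset q.stem_subset fun p hp => q.res_subset (hE' p (by simpa using hp)).1
  · exact (infinite_res_diff (q.infinite s) u).mono fun p hp => ⟨⟨hp.1.1, hp.2⟩, hp.1.2⟩
  · rw [Finset.coe_union]
    exact Set.union_subset_union_right _ fun p hp => (hE' p (by simpa using hp)).1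
  · have h1' := hu (chi (G ∩ side d ρ)) fun i hi => chi_congr ?_
    · rw [hK, Part.mem_some_iff] at h1'
      have hwK := hKC w (chi_eq_one.1 h1'.symm)
      exact hjJ ((hF j w ((hτF j w).2 ⟨hw, hj⟩)).symm.trans hwK)
    · simp only [Set.mem_ofPred_eq, List.mem_append, Cond.mem_sideStem]
      constructor
      · rintro ⟨hiG, his⟩
        rcases hG' hiG with hi' | hi'
        · simp only [Finset.coe_union, List.coe_toFinset, Set.mem_union, Finset.mem_coe,
            Set.mem_ofPred_eq] at hi'
          rcases hi' with hi' | hi'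
          · exact .inl ⟨hi', his⟩
          · exact .inr hi'
        · exact absurd hi'.2 (by omega)
      · rintro (⟨hi', his⟩ | hi')
        · exact ⟨hG (by simp [hi']), his⟩
        · exact ⟨hG (by simp [hi']), (hE' i hi').2⟩

/-- If some constraint is satisfiable for all colorings, then the cross-constraint basis theorem
yields a reservoir on which some functional has only finitely many outputs. -/
theorem Cond.exists_forces_of_full (q : Cond r R₀) {n : ℕ}
    (h : Full (Constraint Φ J (q.sideStem d) q.res n) ([], [])) :
    ∃ q', q.Le q' ∧ q'.Forces C d Φ J := by
  classical
  obtain ⟨X₀, X₁, Y₀, Y₁, N, hX₀, hX₁, hT₀, hT₁, hY, hS⟩ :=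
    exists_cross (prefixClosed_constraint (q.sideStem d) q.res n)
    ((arith_constraint (q.sideStem d) q.arith).comp
      (f := fun t : Pre => (n, t.1, t.2)) primrec_auto) h
    (S := fun s : Fin r => {p | p ∈ q.res ∧ p.unpair.1 = s}) (fun s => q.arith.and .eq) q.infinite
  -- Infinitely many agreements on a column give infinitely many with one fixed value; these values
  -- form the side `ρ` on which to win.
  have hρ : ∀ s : Fin r, ∃ b,
      {p | (p ∈ q.res ∧ p.unpair.1 = s) ∧ X₀ p = b ∧ X₁ p = b}.Infinite := by
    intro s
    by_contra! hn
    refine hS s (((hn true).union (hn false)).subset ?_)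
    rintro p ⟨hp, hp'⟩
    cases hb : X₀ p
    · exact .inr ⟨hp, hb, hp' ▸ hb⟩
    · exact .inl ⟨hp, hb, hp' ▸ hb⟩
  choose ρ hρ using hρ
  have harith : ∀ {X : ℕ → Bool}, (Arith fun x => X x = true) → ∀ b, Arith fun x => X x = b := by
    rintro X hX (_ | _)
    · exact hX.not.congr fun x => by simp
    · exact hX
  refine ⟨⟨q.stem, {p | p ∈ q.res ∧ ∃ s : Fin r, p.unpair.1 = s ∧ X₀ p = ρ s ∧ X₁ p = ρ s},
    q.stem_subset, fun p hp => q.res_subset hp.1, q.arith.and <| .exists_finite fun s =>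
      .and .eq <| .and (harith hX₀ _) (harith hX₁ _), fun s => ?_⟩,
    ⟨subset_rfl, fun p hp => hp.1, Set.subset_union_left⟩, ρ, fun G hG hG' K hKi hKC hK => ?_⟩
  · exact (hρ s).mono fun p hp => ⟨⟨hp.1.1, s, hp.1.2, hp.2⟩, hp.1.2⟩
  · obtain ⟨w, hwK, hw⟩ := hKi.exists_gt (max n N)
    have h1 : 1 ∈ (Φ ρ).eval (chi (G ∩ side d ρ)) w := by
      rw [hK, chi_of_mem hwK]; exact Part.mem_some _
    obtain ⟨u, hu⟩ := OCode.exists_use _ h1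
    set R' : Set ℕ := {p | p ∈ q.res ∧ ∃ s : Fin r, p.unpair.1 = s ∧ X₀ p = ρ s ∧ X₁ p = ρ s}
    set E := (List.range u).filter fun p => p ∈ R' ∧ p ∈ G ∩ side d ρ
    have hE : ∀ p, p ∈ E ↔ p < u ∧ p ∈ R' ∧ p ∈ G ∩ side d ρ := fun p => by simp [E]
    have h1' := hu (chi {p | p ∈ q.sideStem d ρ ++ E}) fun i hi => chi_congr (by
      simp only [Set.mem_ofPred_eq, List.mem_append, Cond.mem_sideStem, hE]
      constructor
      · rintro (⟨hi', his⟩ | ⟨-, -, hi'⟩)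
        · exact ⟨hG hi', his⟩
        · exact hi'
      · intro hi'
        rcases hG' hi'.1 with hs | hs
        · exact .inl ⟨hs, hi'.2⟩
        · exact .inr ⟨hi, hs, hi'⟩)
    have hwn : n < w := (le_max_left _ _).trans_lt hw
    have hwN : N ≤ w := (le_max_right _ _).trans hw.le
    -- The finite part of `G` below the use respects both partitions, so each member of the class
    -- forces its own color at `w` to be `J ρ`.
    have key : ∀ (X : ℕ → Bool) (Y : ℕ → Fin 3),
        (∀ k, Constraint Φ J (q.sideStem d) q.res n ((List.range k).map X)
          ((List.range k).map Y)) →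
        (∀ p ∈ R', ∃ s : Fin r, p.unpair.1 = s ∧ X p = ρ s) → Y w = J ρ := by
      intro X Y hXY hR'
      refine (hXY (max u (w + 1))).2 ρ E (fun p hp => ?_) w hwn h1' (Y w) ?_
      · obtain ⟨hpu, hpR, -⟩ := (hE p).1 hp
        obtain ⟨s, hs, hs'⟩ := hR' p hpR
        refine ⟨hpR.1, s, hs, ?_⟩
        rw [List.getElem?_map, List.getElem?_range (hpu.trans_le (le_max_left _ _)),
          Option.map_some, hs']
      · rw [List.getElem?_map, List.getElem?_range (Nat.lt_succ_self w |>.trans_le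
          (le_max_right _ _)), Option.map_some]
    exact hY w hwN ((key X₀ Y₀ hT₀ fun p ⟨_, s, hs, h₀, _⟩ => ⟨s, hs, h₀⟩).trans
      (key X₁ Y₁ hT₁ fun p ⟨_, s, hs, _, h₁⟩ => ⟨s, hs, h₁⟩).symm)

theorem Cond.exists_forces (hC : ∀ D, IsArithmetic D → HyperimmuneRel C D) (d : ℕ → Bool)
    (Φ : (Fin r → Bool) → OCode) (J : (Fin r → Bool) → Fin 3) (q : Cond r R₀) :
    ∃ q', q.Le q' ∧ q'.Forces C d Φ J := by
  by_cases h : ∃ n, Full (Constraint Φ J (q.sideStem d) q.res n) ([], [])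
  · obtain ⟨n, h⟩ := h
    exact q.exists_forces_of_full h
  · exact q.exists_forces_of_not_full hC (not_exists.1 h)

/-- The successful `ρ` is known only at the end, so both values must occur infinitely often in every
column. -/
theorem Cond.exists_large
    (hsplit : ∀ (s : Fin r) (Z : Set ℕ), Arith (· ∈ Z) → Z.Infinite →
      (∀ p ∈ Z, p ∈ R₀ ∧ p.unpair.1 = s) → ∀ b, {p | p ∈ Z ∧ d p = b}.Infinite)
    (q : Cond r R₀) (m : ℕ) :
    ∃ q', q.Le q' ∧ ∀ (s : Fin r) b, ∃ p ∈ q'.stem, p.unpair.1 = s ∧ d p = b ∧ m < p := by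
  classical
  have h : ∀ (s : Fin r) (b : Bool), ∃ p, (p ∈ q.res ∧ p.unpair.1 = s) ∧ d p = b ∧ m < p := by
    intro s b
    obtain ⟨p, ⟨hp, hp'⟩, hm⟩ := (hsplit s _ (q.arith.and .eq) (q.infinite s)
      (fun p hp => ⟨q.res_subset hp.1, hp.2⟩) b).exists_gt m
    exact ⟨p, hp, hp', hm⟩
  choose f hf hfd hfm using h
  have hA : ∀ p ∈ Finset.univ.image fun t : Fin r × Bool => f t.1 t.2, p ∈ q.res := by
    intro p hp
    obtain ⟨t, -, rfl⟩ := Finset.mem_image.1 hp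
    exact (hf t.1 t.2).1
  refine ⟨⟨q.stem ∪ Finset.univ.image fun t : Fin r × Bool => f t.1 t.2, q.res, ?_, q.res_subset,
    q.arith, q.infinite⟩, ⟨Finset.subset_union_left, subset_rfl, ?_⟩, fun s b => ⟨f s b, ?_,
      (hf s b).2, hfd s b, hfm s b⟩⟩
  · rw [Finset.coe_union]
    exact Set.union_subset q.stem_subset fun p hp => q.res_subset (hA p hp)
  · rw [Finset.coe_union]
    exact Set.union_subset_union_right _ fun p hp => hA p hp
  · exact Finset.mem_union_right _ (Finset.mem_image.2 ⟨(s, b), Finset.mem_univ _, rfl⟩)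

/-- A sufficiently generic set of codes. -/
theorem Cond.exists_generic (hC : ∀ D, IsArithmetic D → HyperimmuneRel C D)
    (hsplit : ∀ (s : Fin r) (Z : Set ℕ), Arith (· ∈ Z) → Z.Infinite →
      (∀ p ∈ Z, p ∈ R₀ ∧ p.unpair.1 = s) → ∀ b, {p | p ∈ Z ∧ d p = b}.Infinite)
    (q₀ : Cond r R₀) :
    ∃ G ⊆ R₀, (∀ (s : Fin r) b, {p | p ∈ G ∧ p.unpair.1 = s ∧ d p = b}.Infinite) ∧
      ∃ ρ : Fin r → Bool, ∀ (c : OCode) (j : Fin 3) (K : Set ℕ), K.Infinite → (∀ x ∈ K, C x = j) →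
        ¬ ∀ n, c.eval (chi (G ∩ side d ρ)) n = Part.some (chi K n) := by
  have : Nonempty ((Fin r → Bool) → OCode × Fin 3) := ⟨fun _ => (.zero, 0)⟩
  -- There are countably many requirements: one program and one color for each of the finitely many
  -- sides.
  obtain ⟨f, hf⟩ := exists_surjective_nat ((Fin r → Bool) → OCode × Fin 3)
  have hstep : ∀ (n : ℕ) (q : Cond r R₀), ∃ q', q.Le q' ∧
      (∀ (s : Fin r) b, ∃ p ∈ q'.stem, p.unpair.1 = s ∧ d p = b ∧ n < p) ∧
      q'.Forces C d (fun ρ => (f n ρ).1) fun ρ => (f n ρ).2 := by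
    intro n q
    obtain ⟨q₁, h₁, hl⟩ := q.exists_large hsplit n
    obtain ⟨q₂, h₂, hF⟩ := q₁.exists_forces hC d (fun ρ => (f n ρ).1) fun ρ => (f n ρ).2
    refine ⟨q₂, h₁.trans h₂, fun s b => ?_, hF⟩
    obtain ⟨p, hp, hp'⟩ := hl s b
    exact ⟨p, h₂.stem hp, hp'⟩
  choose next hle hlarge hforce using hstep
  let q : ℕ → Cond r R₀ := fun n => Nat.rec q₀ next n
  have hmono : ∀ m n, m ≤ n → (q m).Le (q n) := fun m n h => by
    induction n, h using Nat.le_induction with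
    | base => exact .refl _
    | succ n _ ih => exact ih.trans (hle n (q n))
  let G : Set ℕ := ⋃ n, ↑(q n).stem
  have hG : ∀ n, ↑(q n).stem ⊆ G := fun n => Set.subset_iUnion (fun n => (↑(q n).stem : Set ℕ)) n
  have hG' : ∀ n, G ⊆ ↑(q n).stem ∪ (q n).res := fun n => by
    refine Set.iUnion_subset fun m => ?_
    rcases le_total m n with h | h
    · exact (Finset.coe_subset.2 (hmono m n h).stem).trans Set.subset_union_left
    · exact (hmono n m h).new
  refine ⟨G, Set.iUnion_subset fun n => (q n).stem_subset, fun s b => ?_, ?_⟩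
  · refine Set.infinite_of_forall_exists_gt fun n => ?_
    obtain ⟨p, hp, hs, hb, hn⟩ := hlarge n (q n) s b
    exact ⟨p, ⟨hG (n + 1) hp, hs, hb⟩, hn⟩
  · by_contra! hn
    -- If every side computed a solution, the tuple of these programs and colors would be one of the
    -- requirements, and the stage handling it refutes some side.
    choose c j K hK hKj hcK using hn
    obtain ⟨n, hn⟩ := hf fun ρ => (c ρ, j ρ)
    obtain ⟨ρ, hρ⟩ := hforce n (q n)
    rw [hn] at hρ
    exact hρ G (hG (n + 1)) (hG' (n + 1)) (K ρ) (hK ρ) (hKj ρ) (hcK ρ)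

end

/-- No instance of `(RT¹₂)^{<ω}` encodes a coloring that is hyperimmune relative to all arithmetic
sets. -/
theorem not_encodes_of_hyperimmuneRel {C : ℕ → Fin 3}
    (hC : ∀ D, IsArithmetic D → HyperimmuneRel C D) (I : (RT1 2).finPow.Inst) :
    ¬ Encodes (RT1 3) (RT1 2).finPow C I := by
  classical
  obtain ⟨r, c⟩ := I
  change Fin r → ℕ → Fin 2 at c
  choose R e hR hRi hsplit hhom using fun s => exists_splitting hC (c s)
  let R₀ : Set ℕ := {p | ∃ s : Fin r, p.unpair.1 = s ∧ p.unpair.2 ∈ R s}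
  let d : ℕ → Bool := fun p => if h : p.unpair.1 < r then e ⟨_, h⟩ p.unpair.2 else false
  have hd : ∀ (s : Fin r) x, d (Nat.pair s x) = e s x := fun s x => by simp [d]
  have hpair : ∀ s : ℕ, Function.Injective (Nat.pair s) := fun s x y h =>
    (Nat.pair_eq_pair.1 h).2
  have harith : Arith (· ∈ R₀) := .exists_finite fun s => .and .eq <| (hR s).comp primrec_auto
  obtain ⟨G, hG, hGi, ρ, hρ⟩ := Cond.exists_generic (r := r) (R₀ := R₀) (d := d) hC
    (fun s Z hZ hZi hZs b => by
      have hZ' : Z = Nat.pair s '' {x | Nat.pair s x ∈ Z} := by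
        ext p
        constructor
        · intro hp
          have h : Nat.pair s p.unpair.2 = p := by rw [← (hZs p hp).2, Nat.pair_unpair]
          exact ⟨p.unpair.2, by simpa [h] using hp, h⟩
        · rintro ⟨x, hx, rfl⟩
          exact hx
      have hi := hsplit s {x | Nat.pair s x ∈ Z} (hZ.comp primrec_auto)
        (Set.Infinite.of_image _ (hZ' ▸ hZi)) (fun x hx => by
          obtain ⟨⟨t, ht, hx'⟩, -⟩ := hZs _ hx
          rw [Nat.unpair_pair] at ht hx'
          rwa [Fin.ext ht]) b
      refine (hi.image (hpair s).injOn).mono ?_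
      rintro _ ⟨x, ⟨hx, hx'⟩, rfl⟩
      exact ⟨hx, (hd s x).trans hx'⟩)
    ⟨∅, R₀, by simp, subset_rfl, harith, fun s => by
      refine ((hRi s).image (hpair s).injOn).mono ?_
      rintro _ ⟨x, hx, rfl⟩
      exact ⟨⟨s, by simp, by simpa using hx⟩, by simp⟩⟩
  have hjoin : join (fun s : Fin r => {x | Nat.pair s x ∈ G ∧ d (Nat.pair s x) = ρ s}) =
      G ∩ side d ρ := by
    ext p
    simp only [join, side, Set.mem_ofPred_eq, Set.mem_inter_iff]
    constructor
    · rintro ⟨s, hs, h⟩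
      rw [← hs, Nat.pair_unpair] at h
      exact ⟨h.1, s, hs, h.2⟩
    · rintro ⟨hp, s, hs, h⟩
      refine ⟨s, hs, ?_⟩
      rw [← hs, Nat.pair_unpair]
      exact ⟨hp, h⟩
  intro henc
  have hsol : ∀ s : Fin r, (RT1 2).IsSol (c s)
      {x | Nat.pair s x ∈ G ∧ d (Nat.pair s x) = ρ s} := by
    refine fun s => ⟨?_, ?_⟩
    · refine Set.Infinite.of_image (Nat.pair s) ((hGi s (ρ s)).mono ?_)
      rintro p ⟨hp, hs, hp'⟩
      have h : Nat.pair s p.unpair.2 = p := by rw [← hs, Nat.pair_unpair]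
      exact ⟨p.unpair.2, by simpa [h] using ⟨hp, hp'⟩, h⟩
    · obtain ⟨j, hj⟩ := hhom s (ρ s)
      refine ⟨j, fun x hx => hj x ?_ ((hd s x).symm.trans hx.2)⟩
      obtain ⟨t, ht, hx'⟩ := hG hx.1
      rw [Nat.unpair_pair] at ht hx'
      rwa [Fin.ext ht]
  obtain ⟨K, ⟨hK, j, hKj⟩, hred⟩ := henc _ ⟨_, hsol, hjoin.symm⟩
  obtain ⟨a, ha⟩ := hred.exists_eval
  exact hρ a j K hK hKj ha

end SocRed

theorem mainTheorem2 :
    ¬ SocRed.SocReducible (SocRed.RT1 3) (SocRed.RT1 2).finPow ∧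
    ∃ C : ℕ → Fin 3,
      TuringReducible (fun n => Part.some (C n : ℕ))
        (fun n => Part.some (SocRed.chi SocRed.emptyOmegaJump n)) ∧
      (∀ D : Set ℕ, SocRed.IsArithmetic D → SocRed.HyperimmuneRel C D) ∧
      ∀ I : (SocRed.RT1 2).finPow.Inst,
        ¬ SocRed.Encodes (SocRed.RT1 3) (SocRed.RT1 2).finPow C I := by
  obtain ⟨C, hC, hCh⟩ := SocRed.exists_hyperimmuneRel_arithmetic
  have h := SocRed.not_encodes_of_hyperimmuneRel hCh
  refine ⟨fun hred => ?_, C, hC, hCh, h⟩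
  obtain ⟨I, hI⟩ := hred C
  exact h I hI
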